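/- **Setting.** An RDF graph $D$ is a set of triples. A triple pattern (TP) has a variable or a fixed term in each of its subject, predicate and object positions. A nested BGP–OPTIONAL query $Q$ is built from OPT-free basic graph patterns (BGPs: nonempty finite families of TPs) by inner joins $P\Join P'$ and left-outer-joins $P \mathbin{\mathrm{OPT}} P'$, and is written in terms of its maximal OPT-free BGPs. A *join variable* (jvar) is a variable that occurs in at least two TPs of $Q$. *Graph of supernodes.* There is one supernode per OPT-free BGP. Every subpattern $P \mathbin{\mathrm{OPT}} P'$ gives a directed edge, and every subpattern $P\Join P'$ gives a bidirectional edge, from the leftmost supernode of $P$ to the leftmost supernode of $P'$. A supernode $A$ is a *master* of $B$ (and $B$ a *slave* of $A$) if $B$ is reachable from $A$ by a path with at least one directed edge; distinct supernodes linked by bidirectional edges only are *peers*; a supernode without masters is an *absolute master*. These terms also apply to the TPs inside the supernodes. *Graph of join variables (GoJ).* Its nodes are the jvars, and every TP contributes an edge between any two distinct jvars that occur in it. *Acyclic* means without cycles in this multigraph; in particular, no two TPs share two jvars. *Hypotheses.* (1) $Q$ is well-designed: for every subpattern $P'=(P_k \mathbin{\mathrm{OPT}} P_l)$, each variable of $P_l$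 that occurs outside $P'$ occurs in $P_k$. (2) $Q$ has no Cartesian products: the TPs of each supernode are connected to each other through shared variables, so are the TPs of each supernode together with its peers, and each slave supernode shares a jvar with one of its masters. (3) The GoJ of $Q$ is acyclic. *Algorithm 1 (`get_jvar_order`).* Let $J_m$ be the set of jvars in absolute masters. Choose a least selective $j\in J_m$ as root of the subtree of the GoJ induced on $J_m$. List the slave supernodes with masters before their slaves and, among peers, more selective ones first. For each slave supernode take the subtree of the GoJ induced on its jvars, rooted at one of its jvars that also occurs in a master of it. The list $order_{bu}$ is a bottom-up listing of the tree on $J_m$ followed by bottom-up listings of the trees of the slave supernodes, in the above order; $order_{td}$ is the same with top-down listings. (If there is no jvar, both lists are empty.) *Algorithm 2 (`prune_triples`).* Each TP starts with the set $\Delta_{tp}$ of all triples of $D$ that match it. For each jvar $j$ in $order_{bu}$, and then for each $j$ in $order_{td}$: first, for all TPs $tp_a$, $tp_b$ containing $j$ such that $tp_b$ is a slave of $tp_a$, do the semi-join $tp_b\ltimes_j tp_a$, i.e. keep in $\Delta_{tp_b}$ only the triples whose value of $j$ also occurs in $\Delta_{tp_a}$; then, for each supernode in which $j$ occurs, do the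 clustered-semi-join on $j$ over all TPs that contain $j$ in this supernode and its peers, i.e. keep in each of them only the triples whose value of $j$ occurs in all of them. **Claim.** Under hypotheses (1)–(3), for every RDF graph $D$, every ranking of the jvars and supernodes by selectivity, every order in which the loops of Algorithm 2 run through the TPs and supernodes, Algorithm 1 has an output, and for each of its possible outputs $(order_{bu},order_{td})$ Algorithm 2 leaves every TP of $Q$ with a minimal set of triples: $\Delta_{tp}$ is exactly the set of triples that $tp$ contributes to some final result of $Q$ on $D$. Here a final result carries, for every TP, the triple matched by that TP, or NULL if the TP lies in an optional part that is not matched in this result. -/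

import Mathlib

namespace LBR

/-- A position of a triple pattern holds a variable or a fixed RDF term. -/
inductive Term (V C : Type*) where
  | var (v : V)
  | const (c : C)

/-- A triple pattern; the positions `0`, `1`, `2` are subject, predicate and object. -/
abbrev TriplePattern (V C : Type*) := Fin 3 → Term V C

/-- An RDF triple; an RDF graph is a set of triples. -/
abbrev Triple (C : Type*) := Fin 3 → C

namespace TriplePattern

variable {V C : Type*}

/-- The variables of a triple pattern. -/
def vars (p : TriplePattern V C) : Set V := {v | ∃ k, p k = Term.var v}

/-- The triple obtained from `p` by replacing every variable by its value under `μ`. -/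
def inst (μ : V → C) (p : TriplePattern V C) : Triple C := fun k =>
  match p k with
  | Term.var v => μ v
  | Term.const c => c

/-- The triple `t` matches the triple pattern `p`. -/
def Matches (p : TriplePattern V C) (t : Triple C) : Prop := ∃ μ : V → C, p.inst μ = t

/-- The triple `t`, read as a match of `p`, gives the variable `v` the value `c`. -/
def Binds (p : TriplePattern V C) (t : Triple C) (v : V) (c : C) : Prop :=
  ∃ k, p k = Term.var v ∧ t k = c

end TriplePattern

/-- A nested BGP-OPT query: OPT-free basic graph patterns (nonempty finite families of triple
patterns), combined by inner joins and by left-outer-joins. -/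
inductive Pattern (V C : Type*) where
  | bgp (n : ℕ) (t : Fin (n + 1) → TriplePattern V C)
  | join (P Q : Pattern V C)
  | opt (P Q : Pattern V C)

namespace Pattern

variable {V C : Type*}

/-- No left-outer-join occurs in the pattern. -/
def OptFree : Pattern V C → Prop
  | bgp _ _ => True
  | join P Q => P.OptFree ∧ Q.OptFree
  | opt _ _ => False

/-- The query is written in terms of its maximal OPT-free BGPs: the inner join of two OPT-free
patterns is OPT-free, so it is written as one BGP. -/
def Serialized : Pattern V C → Prop
  | bgp _ _ => True
  | join P Q => P.Serialized ∧ Q.Serialized ∧ ¬ (P.OptFree ∧ Q.OptFree)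
  | opt P Q => P.Serialized ∧ Q.Serialized

/-- The occurrences of triple patterns (TPs) in the query. -/
@[reducible] def Occ : Pattern V C → Type
  | bgp n _ => Fin (n + 1)
  | join P Q => P.Occ ⊕ Q.Occ
  | opt P Q => P.Occ ⊕ Q.Occ

/-- The triple pattern at an occurrence. -/
def tp : (P : Pattern V C) → P.Occ → TriplePattern V C
  | bgp _ t => t
  | join P Q => Sum.elim P.tp Q.tp
  | opt P Q => Sum.elim P.tp Q.tp

/-- The variables of the TP at the occurrence `i`. -/
def tpVars (P : Pattern V C) (i : P.Occ) : Set V := (P.tp i).vars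

/-- The variables of a pattern. -/
def vars (P : Pattern V C) : Set V := {v | ∃ i, v ∈ P.tpVars i}

/-! ### The graph of supernodes (GoSN) -/

/-- The supernodes: one for every OPT-free BGP of the query. -/
@[reducible] def SN : Pattern V C → Type
  | bgp _ _ => Unit
  | join P Q => P.SN ⊕ Q.SN
  | opt P Q => P.SN ⊕ Q.SN

/-- The supernode that encapsulates a TP. -/
def sn : (P : Pattern V C) → P.Occ → P.SN
  | bgp _ _ => fun _ => ()
  | join P Q => Sum.map P.sn Q.sn
  | opt P Q => Sum.map P.sn Q.sn

/-- The supernode of the leftmost OPT-free BGP. -/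
def leftmost : (P : Pattern V C) → P.SN
  | bgp _ _ => ()
  | join P _ => Sum.inl P.leftmost
  | opt P _ => Sum.inl P.leftmost

/-- The unidirectional edges: every `P ⟕ Q` gives an edge from the leftmost supernode of `P` to
the leftmost supernode of `Q`. -/
def Uni : (P : Pattern V C) → P.SN → P.SN → Prop
  | bgp _ _ => fun _ _ => False
  | join P Q => fun a b => match a, b with
    | Sum.inl a, Sum.inl b => P.Uni a b
    | Sum.inr a, Sum.inr b => Q.Uni a b
    | _, _ => False
  | opt P Q => fun a b => match a, b with
    | Sum.inl a, Sum.inl b => P.Uni a b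
    | Sum.inr a, Sum.inr b => Q.Uni a b
    | Sum.inl a, Sum.inr b => a = P.leftmost ∧ b = Q.leftmost
    | Sum.inr _, Sum.inl _ => False

/-- The bidirectional edges: every `P ⋈ Q` gives an edge between the leftmost supernode of `P`
and the leftmost supernode of `Q`. -/
def Bi : (P : Pattern V C) → P.SN → P.SN → Prop
  | bgp _ _ => fun _ _ => False
  | join P Q => fun a b => match a, b with
    | Sum.inl a, Sum.inl b => P.Bi a b
    | Sum.inr a, Sum.inr b => Q.Bi a b
    | Sum.inl a, Sum.inr b => a = P.leftmost ∧ b = Q.leftmost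
    | Sum.inr b, Sum.inl a => a = P.leftmost ∧ b = Q.leftmost
  | opt P Q => fun a b => match a, b with
    | Sum.inl a, Sum.inl b => P.Bi a b
    | Sum.inr a, Sum.inr b => Q.Bi a b
    | _, _ => False

/-- An edge of the GoSN, traversed in an allowed direction. -/
def Edge (P : Pattern V C) (a b : P.SN) : Prop := P.Uni a b ∨ P.Bi a b

/-- `a` is a master of `b` (and `b` a slave of `a`): `b` is reachable from `a` along a path of
the GoSN with at least one unidirectional edge. -/
def Master (P : Pattern V C) (a b : P.SN) : Prop :=
  ∃ c d, Relation.ReflTransGen P.Edge a c ∧ P.Uni c d ∧ Relation.ReflTransGen P.Edge d b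

/-- Two different supernodes are peers if they are linked by bidirectional edges only. -/
def Peer (P : Pattern V C) (a b : P.SN) : Prop := a ≠ b ∧ Relation.ReflTransGen P.Bi a b

/-- The supernode `b` has no master. -/
def AbsoluteMaster (P : Pattern V C) (b : P.SN) : Prop := ∀ a, ¬ P.Master a b

/-- The supernode `b` has a master. -/
def Slave (P : Pattern V C) (b : P.SN) : Prop := ∃ a, P.Master a b

/-- A supernode together with its peers. -/
def withPeers (P : Pattern V C) (s : P.SN) : Set P.SN := {s' | s' = s ∨ P.Peer s s'}

/-! ### Join variables and their graph (GoJ) -/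

/-- A join variable (jvar) occurs in at least two TPs. -/
def IsJvar (P : Pattern V C) (v : V) : Prop :=
  ∃ i k : P.Occ, i ≠ k ∧ v ∈ P.tpVars i ∧ v ∈ P.tpVars k

/-- The jvars that occur in a given set of supernodes. -/
def jvarsOf (P : Pattern V C) (A : Set P.SN) : Set V :=
  {v | P.IsJvar v ∧ ∃ i, P.sn i ∈ A ∧ v ∈ P.tpVars i}

/-- The graph of join variables: two jvars are adjacent if they appear together in a TP
(variables that are not jvars are isolated and play no role). -/
def goj (P : Pattern V C) : SimpleGraph V where
  Adj a b := a ≠ b ∧ P.IsJvar a ∧ P.IsJvar b ∧ ∃ i, a ∈ P.tpVars i ∧ b ∈ P.tpVars i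
  symm := ⟨fun _ _ ⟨h, ha, hb, i, hi, hi'⟩ => ⟨h.symm, hb, ha, i, hi', hi⟩⟩
  loopless := ⟨fun _ h => h.1 rfl⟩

/-- The GoJ is acyclic. Every TP contributes its own edges, so two TPs that share two jvars form
a cycle of length two; the first conjunct excludes the longer cycles and the second one excludes
the cycles of length two. -/
def GojAcyclic (P : Pattern V C) : Prop :=
  P.goj.IsAcyclic ∧
    ∀ i k : P.Occ, i ≠ k → ∀ a b : V, a ≠ b →
      ¬ (a ∈ P.tpVars i ∧ b ∈ P.tpVars i ∧ a ∈ P.tpVars k ∧ b ∈ P.tpVars k)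

/-! ### The class of queries -/

/-- Auxiliary form of well-designedness for a subpattern; `out` is the set of the variables that
occur in the query outside the subpattern. -/
def WellDesignedIn : Pattern V C → Set V → Prop
  | bgp _ _, _ => True
  | join P Q, out => P.WellDesignedIn (out ∪ Q.vars) ∧ Q.WellDesignedIn (out ∪ P.vars)
  | opt P Q, out => (∀ v ∈ Q.vars, v ∈ out → v ∈ P.vars) ∧
      P.WellDesignedIn (out ∪ Q.vars) ∧ Q.WellDesignedIn (out ∪ P.vars)

/-- Well-designed: for every subpattern `P' = P ⟕ Q`, a variable of `Q` that occurs outside `P'`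
also occurs in `P`. -/
def WellDesigned (P : Pattern V C) : Prop := P.WellDesignedIn ∅

/-- The TPs in the given supernodes are connected to each other through shared variables. -/
def Linked (P : Pattern V C) (A : Set P.SN) : Prop :=
  ∀ i k : P.Occ, P.sn i ∈ A → P.sn k ∈ A →
    Relation.ReflTransGen
      (fun a b : P.Occ => P.sn a ∈ A ∧ P.sn b ∈ A ∧ (P.tpVars a ∩ P.tpVars b).Nonempty) i k

/-- No Cartesian products: neither an OPT-free BGP, nor its inner join with its peers, nor a
left-outer-join with its masters falls apart into two parts without a common variable. -/
structure NoCartesianProducts (P : Pattern V C) : Prop where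
  bgps : ∀ s : P.SN, P.Linked {s}
  peers : ∀ s : P.SN, P.Linked (P.withPeers s)
  slaves : ∀ s : P.SN, P.Slave s → (P.jvarsOf {s} ∩ P.jvarsOf {m | P.Master m s}).Nonempty

/-! ### Final results -/

/-- A result row, with all positions of all TPs selected: for every TP the triple that it
matches, or `none` if the positions of that TP are NULL. -/
abbrev Row (P : Pattern V C) := P.Occ → Option (Triple C)

/-- The row binds the variable `v` to the value `c`. -/
def RowBinds (P : Pattern V C) (r : P.Row) (v : V) (c : C) : Prop :=
  ∃ i t, r i = some t ∧ (P.tp i).Binds t v c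

/-- Two rows agree on all variables that are bound in both. -/
def Compatible (P Q : Pattern V C) (r : P.Row) (s : Q.Row) : Prop :=
  ∀ v c d, P.RowBinds r v c → Q.RowBinds s v d → c = d

/-- The final results of the query on the RDF graph `D`. -/
def eval (D : Set (Triple C)) : (P : Pattern V C) → Set P.Row
  | bgp _ t => {r | ∃ μ : V → C, ∀ i, (t i).inst μ ∈ D ∧ r i = some ((t i).inst μ)}
  | join P Q => {x | ∃ r ∈ P.eval D, ∃ s ∈ Q.eval D, Compatible P Q r s ∧ x = Sum.elim r s}
  | opt P Q =>
      {x | ∃ r ∈ P.eval D, ∃ s ∈ Q.eval D, Compatible P Q r s ∧ x = Sum.elim r s} ∪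
      {x | ∃ r ∈ P.eval D, (∀ s ∈ Q.eval D, ¬ Compatible P Q r s) ∧
        x = Sum.elim r (fun _ => none)}

/-- The triples that the TP `i` contributes to the final results: the non-NULL projection of the
final results on the three positions of the TP. -/
def resultTriples (P : Pattern V C) (D : Set (Triple C)) (i : P.Occ) : Set (Triple C) :=
  {t | ∃ r ∈ P.eval D, r i = some t}

/-! ### Semi-joins and `prune_triples` -/

/-- The sets of triples currently associated with the TPs. -/
abbrev State (P : Pattern V C) := P.Occ → Set (Triple C)

/-- At the start, every TP is associated with all triples of the graph that match it. -/
def matchingTriples (P : Pattern V C) (D : Set (Triple C)) : P.State :=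
  fun i => {t | t ∈ D ∧ (P.tp i).Matches t}

/-- The values of `j` in the triples associated with the TP `i`. -/
def proj (P : Pattern V C) (Δ : P.State) (i : P.Occ) (j : V) : Set C :=
  {c | ∃ t ∈ Δ i, (P.tp i).Binds t j c}

/-- The semi-join `b ⋉_j a`; only the triples of the TP `b` change. -/
def semiJoin (P : Pattern V C) (j : V) (b a : P.Occ) (Δ : P.State) : P.State :=
  fun k => {t | t ∈ Δ k ∧
    (k = b → ∃ c ∈ P.proj Δ a j ∩ P.proj Δ b j, (P.tp k).Binds t j c)}

/-- The clustered-semi-join on `j` over a set `S` of TPs; only the TPs in `S` change. -/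
def clusteredSemiJoin (P : Pattern V C) (j : V) (S : Set P.Occ) (Δ : P.State) : P.State :=
  fun k => {t | t ∈ Δ k ∧
    (k ∈ S → ∃ c, (∀ i ∈ S, c ∈ P.proj Δ i j) ∧ (P.tp k).Binds t j c)}

open Classical in
/-- For each TP `a`, for each TP `b` that is a slave of `a` and shares `j` with it, do `b ⋉_j a`.
The list `tps` is the order in which the loops run through the TPs. -/
noncomputable def semiJoinLoop (P : Pattern V C) (tps : List P.Occ) (j : V) (Δ : P.State) :
    P.State :=
  tps.foldl (fun Δ a => tps.foldl (fun Δ b =>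
    if P.Master (P.sn a) (P.sn b) ∧ j ∈ P.tpVars a ∧ j ∈ P.tpVars b then P.semiJoin j b a Δ
    else Δ) Δ) Δ

open Classical in
/-- For each supernode `s` in which `j` occurs, do a clustered-semi-join on `j` over the TPs with
`j` in `s` and its peers. The list `sns` is the order in which the loop runs. -/
noncomputable def clusteredLoop (P : Pattern V C) (sns : List P.SN) (j : V) (Δ : P.State) :
    P.State :=
  sns.foldl (fun Δ s =>
    if ∃ i, P.sn i = s ∧ j ∈ P.tpVars i then
      P.clusteredSemiJoin j {i | j ∈ P.tpVars i ∧ P.sn i ∈ P.withPeers s} Δ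
    else Δ) Δ

/-- One pass over a list of jvars. -/
noncomputable def prunePass (P : Pattern V C) (tps : List P.Occ) (sns : List P.SN)
    (order : List V) (Δ : P.State) : P.State :=
  order.foldl (fun Δ j => P.clusteredLoop sns j (P.semiJoinLoop tps j Δ)) Δ

/-- `prune_triples`: a pass along `bu`, followed by a pass along `td`. -/
noncomputable def pruneTriples (P : Pattern V C) (tps : List P.Occ) (sns : List P.SN)
    (bu td : List V) (Δ : P.State) : P.State :=
  P.prunePass tps sns td (P.prunePass tps sns bu Δ)

/-! ### `get_jvar_order` -/

end Pattern

/-- In the subtree of `G` induced on `S` and rooted at `root`, the node `b` is a proper ancestor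
of the node `a`: it lies on the path from the root to `a`. -/
def ProperAncestor {V : Type*} (G : SimpleGraph V) (S : Set V) (root b a : V) : Prop :=
  a ∈ S ∧ b ∈ S ∧ b ≠ a ∧ ∀ w : G.Walk root a, (∀ x ∈ w.support, x ∈ S) → b ∈ w.support

/-- `l` lists the nodes of the induced subtree, every node after its descendants. -/
def BottomUp {V : Type*} (G : SimpleGraph V) (S : Set V) (root : V) (l : List V) : Prop :=
  l.Nodup ∧ (∀ v, v ∈ l ↔ v ∈ S) ∧ l.Pairwise (fun u w => ¬ ProperAncestor G S root u w)

/-- `l` lists the nodes of the induced subtree, every node after its ancestors. -/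
def TopDown {V : Type*} (G : SimpleGraph V) (S : Set V) (root : V) (l : List V) : Prop :=
  l.Nodup ∧ (∀ v, v ∈ l ↔ v ∈ S) ∧ l.Pairwise (fun u w => ¬ ProperAncestor G S root w u)

namespace Pattern

variable {V C : Type*}

/-- The jvars in the absolute masters. -/
def masterJvars (P : Pattern V C) : Set V := P.jvarsOf {s | P.AbsoluteMaster s}

/-- The possible roots for the subtree of a slave supernode `s`: the jvars of `s` that also occur
in a master of `s`. -/
def slaveRoots (P : Pattern V C) (s : P.SN) : Set V :=
  P.jvarsOf {s} ∩ P.jvarsOf {m | P.Master m s}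

/-- `l` lists the slave supernodes, masters before their slaves, and among peers the more
selective ones (those with smaller `ssel`) first. -/
def SlaveOrder (P : Pattern V C) (ssel : P.SN → ℕ) (l : List P.SN) : Prop :=
  l.Nodup ∧ (∀ s, s ∈ l ↔ P.Slave s) ∧
    l.Pairwise (fun s s' => ¬ P.Master s' s ∧ (P.Peer s s' → ssel s ≤ ssel s'))

/-- The acyclic case of `get_jvar_order`, for the chosen order `ss` of the slave supernodes. If
the absolute masters have no jvar at all (a query with a single TP), then their tree is empty. -/
def AcyclicJvarOrder (P : Pattern V C) (jsel : V → ℕ) (ss : List P.SN) (bu td : List V) : Prop :=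
  ∃ (bum tdm : List V) (bus tds : P.SN → List V),
    ((P.masterJvars = ∅ ∧ bum = [] ∧ tdm = []) ∨
      ∃ root ∈ P.masterJvars, (∀ j ∈ P.masterJvars, jsel j ≤ jsel root) ∧
        BottomUp P.goj P.masterJvars root bum ∧ TopDown P.goj P.masterJvars root tdm) ∧
    (∀ s ∈ ss, ∃ root ∈ P.slaveRoots s, BottomUp P.goj (P.jvarsOf {s}) root (bus s)) ∧
    (∀ s ∈ ss, ∃ root ∈ P.slaveRoots s, TopDown P.goj (P.jvarsOf {s}) root (tds s)) ∧
    bu = bum ++ ss.flatMap bus ∧ td = tdm ++ ss.flatMap tds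

/-- `(bu, td)` is a possible output of `get_jvar_order`. The numbers `jsel` and `ssel` rank the
jvars and the supernodes by selectivity; a smaller number means more selective. Choices that are
not fixed by the ranking are left open. -/
def JvarOrder (P : Pattern V C) (jsel : V → ℕ) (ssel : P.SN → ℕ) (bu td : List V) : Prop :=
  (¬ P.GojAcyclic ∧ bu = td ∧ bu.Nodup ∧ (∀ v, v ∈ bu ↔ P.IsJvar v) ∧
      bu.Pairwise (fun u w => jsel u ≤ jsel w)) ∨
  (P.GojAcyclic ∧ ∃ ss, P.SlaveOrder ssel ss ∧ P.AcyclicJvarOrder jsel ss bu td)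

end Pattern

end LBR

/-!
The peer classes of the graph of supernodes form a tree: `exists_parent` says that the masters of a
slave supernode are the supernodes that reach one parent. In a well-designed query a variable that
occurs on both sides of an edge of this tree occurs at its upper end
(`exists_sameClass_of_uni`).

*One step.* Whatever the order of the inner loops, all semi-joins and clustered-semi-joins on a
jvar `j` together keep a triple of a TP exactly if its value of `j` occurs in every TP with `j` in
the same peer class or in a master (`clusteredLoop_semiJoinLoop`). Such a step never removes a
triple of a final result (`resultTriples_le_step`), since a final result that matches a TP also
matches its peers and masters. It remains to show that every surviving triple contributes.

*Two passes.* By acyclicity two disjoint connected sets of TPs share at most one variable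
(`GojAcyclic.eq_of_mem_of_disjoint`). So a slave supernode shares only the root of its tree with
its peers and masters; adjacent jvars are parent and child in the tree, and such a pair occurs in
only one TP (`blockForest`). After the bottom-up pass the values at the lower jvar of
each TP are supported, and later steps do not spoil this (`BlockForest.stable_of_hangs_run`). In
the top-down pass a step on `j` therefore only changes TPs with upper jvar `j`, and their lower jvar
is treated later; at the end all triples are supported for all variables
(`BlockForest.stable_run`).

*Completeness.* A supported triple of a TP `i` is extended TP by TP to a match of all TPs in the
class of `i` and its masters (`exists_match`), going to peers and from slaves to masters only; each
new TP shares a single variable with those matched before. Such a match extends to a final result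
because the query is well-designed (`exists_mem_eval`).
-/

namespace LBR
namespace Pattern

variable {V C : Type*}

/-! ### The tree of peer classes -/

theorem finite_occ : ∀ P : Pattern V C, Finite P.Occ
  | bgp n _ => inferInstanceAs (Finite (Fin (n + 1)))
  | join P Q => by
    have := finite_occ P
    have := finite_occ Q
    exact inferInstanceAs (Finite (P.Occ ⊕ Q.Occ))
  | opt P Q => by
    have := finite_occ P
    have := finite_occ Q
    exact inferInstanceAs (Finite (P.Occ ⊕ Q.Occ))

theorem finite_sn : ∀ P : Pattern V C, Finite P.SN
  | bgp _ _ => inferInstanceAs (Finite Unit)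
  | join P Q => by
    have := finite_sn P
    have := finite_sn Q
    exact inferInstanceAs (Finite (P.SN ⊕ Q.SN))
  | opt P Q => by
    have := finite_sn P
    have := finite_sn Q
    exact inferInstanceAs (Finite (P.SN ⊕ Q.SN))

/-- Reachability in the GoSN: `a` is a master of `b`, or a peer of `b`, or `b` itself. -/
def Reach (P : Pattern V C) : P.SN → P.SN → Prop := Relation.ReflTransGen P.Edge

/-- Reachability along bidirectional edges: `b` is `a` or a peer of `a`. -/
def SameClass (P : Pattern V C) : P.SN → P.SN → Prop := Relation.ReflTransGen P.Bi

/-- The number of left-outer-joins that have the supernode on their right-hand side. -/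
def depth : (P : Pattern V C) → P.SN → ℕ
  | bgp _ _ => fun _ => 0
  | join P Q => Sum.elim P.depth Q.depth
  | opt P Q => Sum.elim P.depth (fun b => Q.depth b + 1)

open Classical in
/-- The leftmost supernode of the peer class of a supernode. -/
noncomputable def rep : (P : Pattern V C) → P.SN → P.SN
  | bgp _ _ => id
  | join P Q => Sum.elim (fun a => Sum.inl (P.rep a))
      (fun b => if Q.rep b = Q.leftmost then Sum.inl P.leftmost else Sum.inr (Q.rep b))
  | opt P Q => Sum.map P.rep Q.rep

@[simp] theorem depth_leftmost : ∀ P : Pattern V C, P.depth P.leftmost = 0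
  | bgp _ _ => rfl
  | join P _ => depth_leftmost P
  | opt P _ => depth_leftmost P

@[simp] theorem rep_leftmost : ∀ P : Pattern V C, P.rep P.leftmost = P.leftmost
  | bgp _ _ => rfl
  | join P _ => congrArg Sum.inl (rep_leftmost P)
  | opt P _ => congrArg Sum.inl (rep_leftmost P)

theorem depth_uni : ∀ (P : Pattern V C) {a b : P.SN}, P.Uni a b → P.depth b = P.depth a + 1
  | bgp _ _, _, _, h => h.elim
  | join P Q, Sum.inl _, Sum.inl _, h => depth_uni P h
  | join P Q, Sum.inr _, Sum.inr _, h => depth_uni Q h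
  | join P Q, Sum.inl _, Sum.inr _, h => h.elim
  | join P Q, Sum.inr _, Sum.inl _, h => h.elim
  | opt P Q, Sum.inl _, Sum.inl _, h => depth_uni P h
  | opt P Q, Sum.inr _, Sum.inr _, h => congrArg (· + 1) (depth_uni Q h)
  | opt P Q, Sum.inl _, Sum.inr _, ⟨h, h'⟩ => by
    subst h h'
    simp [depth]
  | opt P Q, Sum.inr _, Sum.inl _, h => h.elim

theorem depth_bi : ∀ (P : Pattern V C) {a b : P.SN}, P.Bi a b → P.depth b = P.depth a
  | bgp _ _, _, _, h => h.elim
  | join P Q, Sum.inl _, Sum.inl _, h => depth_bi P h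
  | join P Q, Sum.inr _, Sum.inr _, h => depth_bi Q h
  | join P Q, Sum.inl _, Sum.inr _, ⟨h, h'⟩ => by
    subst h h'
    simp [depth]
  | join P Q, Sum.inr _, Sum.inl _, ⟨h, h'⟩ => by
    subst h h'
    simp [depth]
  | opt P Q, Sum.inl _, Sum.inl _, h => depth_bi P h
  | opt P Q, Sum.inr _, Sum.inr _, h => congrArg (· + 1) (depth_bi Q h)
  | opt P Q, Sum.inl _, Sum.inr _, h => h.elim
  | opt P Q, Sum.inr _, Sum.inl _, h => h.elim

theorem bi_symm : ∀ (P : Pattern V C) {a b : P.SN}, P.Bi a b → P.Bi b a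
  | bgp _ _, _, _, h => h
  | join P _, Sum.inl _, Sum.inl _, h => bi_symm P h
  | join _ Q, Sum.inr _, Sum.inr _, h => bi_symm Q h
  | join _ _, Sum.inl _, Sum.inr _, h => h
  | join _ _, Sum.inr _, Sum.inl _, h => h
  | opt P _, Sum.inl _, Sum.inl _, h => bi_symm P h
  | opt _ Q, Sum.inr _, Sum.inr _, h => bi_symm Q h
  | opt _ _, Sum.inl _, Sum.inr _, h => h
  | opt _ _, Sum.inr _, Sum.inl _, h => h

theorem rep_bi : ∀ (P : Pattern V C) {a b : P.SN}, P.Bi a b → P.rep a = P.rep b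
  | bgp _ _, _, _, h => h.elim
  | join P Q, Sum.inl _, Sum.inl _, h => congrArg Sum.inl (rep_bi P h)
  | join P Q, Sum.inr _, Sum.inr _, h => by
    have h : Q.rep _ = Q.rep _ := rep_bi Q h
    simp only [rep, Sum.elim_inr]
    rw [h]
  | join P Q, Sum.inl _, Sum.inr _, ⟨h, h'⟩ => by
    subst h h'
    simp [rep]
  | join P Q, Sum.inr _, Sum.inl _, ⟨h, h'⟩ => by
    subst h h'
    simp [rep]
  | opt P Q, Sum.inl _, Sum.inl _, h => congrArg Sum.inl (rep_bi P h)
  | opt P Q, Sum.inr _, Sum.inr _, h => congrArg Sum.inr (rep_bi Q h)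
  | opt P Q, Sum.inl _, Sum.inr _, h => h.elim
  | opt P Q, Sum.inr _, Sum.inl _, h => h.elim

theorem rep_uni : ∀ (P : Pattern V C) {a b : P.SN}, P.Uni a b → P.rep b = b
  | bgp _ _, _, _, h => h.elim
  | join P Q, Sum.inl _, Sum.inl _, h => congrArg Sum.inl (rep_uni P h)
  | join P Q, Sum.inr a, Sum.inr b, h => by
    have hb : b ≠ Q.leftmost := by
      rintro rfl
      have := depth_uni Q h
      simp at this
    simp [rep, rep_uni Q h, hb]
  | join P Q, Sum.inl _, Sum.inr _, h => h.elim
  | join P Q, Sum.inr _, Sum.inl _, h => h.elim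
  | opt P Q, Sum.inl _, Sum.inl _, h => congrArg Sum.inl (rep_uni P h)
  | opt P Q, Sum.inr _, Sum.inr _, h => congrArg Sum.inr (rep_uni Q h)
  | opt P Q, Sum.inl _, Sum.inr _, ⟨_, h'⟩ => by
    subst h'
    simp [rep]
  | opt P Q, Sum.inr _, Sum.inl _, h => h.elim

theorem uni_left_unique : ∀ (P : Pattern V C) {a a' b : P.SN}, P.Uni a b → P.Uni a' b → a = a'
  | bgp _ _, _, _, _, h, _ => h.elim
  | join P Q, Sum.inl _, Sum.inl _, Sum.inl _, h, h' => congrArg Sum.inl (uni_left_unique P h h')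
  | join P Q, Sum.inr _, Sum.inr _, Sum.inr _, h, h' => congrArg Sum.inr (uni_left_unique Q h h')
  | join P Q, Sum.inl _, _, Sum.inr _, h, _ => h.elim
  | join P Q, Sum.inr _, _, Sum.inl _, h, _ => h.elim
  | join P Q, _, Sum.inl _, Sum.inr _, _, h => h.elim
  | join P Q, _, Sum.inr _, Sum.inl _, _, h => h.elim
  | opt P Q, Sum.inl _, Sum.inl _, Sum.inl _, h, h' => congrArg Sum.inl (uni_left_unique P h h')
  | opt P Q, Sum.inr _, Sum.inr _, Sum.inr _, h, h' => congrArg Sum.inr (uni_left_unique Q h h')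
  | opt P Q, Sum.inr _, _, Sum.inl _, h, _ => h.elim
  | opt P Q, _, Sum.inr _, Sum.inl _, _, h => h.elim
  | opt P Q, Sum.inl _, Sum.inl _, Sum.inr _, h, h' => congrArg Sum.inl (h.1.trans h'.1.symm)
  | opt P Q, Sum.inl _, Sum.inr _, Sum.inr _, h, h' => by
    have := depth_uni Q h'
    simp [h.2] at this
  | opt P Q, Sum.inr _, Sum.inl _, Sum.inr _, h', h => by
    have := depth_uni Q h'
    simp [h.2] at this

theorem SameClass.symm {P : Pattern V C} {a b : P.SN} (h : P.SameClass a b) : P.SameClass b a := by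
  have : Std.Symm P.Bi := ⟨fun _ _ => bi_symm P⟩
  exact Relation.ReflTransGen.stdSymm.symm _ _ h

theorem SameClass.reach {P : Pattern V C} {a b : P.SN} (h : P.SameClass a b) : P.Reach a b :=
  Relation.ReflTransGen.mono (fun _ _ h => Or.inr h) _ _ h

theorem SameClass.depth_eq {P : Pattern V C} {a b : P.SN} (h : P.SameClass a b) :
    P.depth b = P.depth a := by
  induction h with
  | refl => rfl
  | tail _ h ih => exact (depth_bi P h).trans ih

theorem Reach.depth_le {P : Pattern V C} {a b : P.SN} (h : P.Reach a b) :
    P.depth a ≤ P.depth b := by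
  induction h with
  | refl => exact le_rfl
  | tail _ h ih =>
    rcases h with h | h
    · have := depth_uni P h
      omega
    · exact ih.trans (depth_bi P h).ge

theorem Master.reach {P : Pattern V C} {a b : P.SN} (h : P.Master a b) : P.Reach a b := by
  obtain ⟨c, d, h₁, h₂, h₃⟩ := h
  exact (h₁.tail (Or.inl h₂)).trans h₃

theorem Master.depth_lt {P : Pattern V C} {a b : P.SN} (h : P.Master a b) :
    P.depth a < P.depth b := by
  obtain ⟨c, d, h₁, h₂, h₃⟩ := h
  have h₁ := Reach.depth_le h₁
  have h₃ := Reach.depth_le h₃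
  have h₂ := depth_uni P h₂
  omega

theorem reach_iff {P : Pattern V C} {a b : P.SN} :
    P.Reach a b ↔ P.SameClass a b ∨ P.Master a b := by
  refine ⟨fun h => ?_, fun h => h.elim SameClass.reach Master.reach⟩
  induction h with
  | refl => exact Or.inl .refl
  | @tail b c hab h ih =>
    rcases h with h | h
    · exact Or.inr ⟨b, c, hab, h, .refl⟩
    · rcases ih with ih | ⟨d, e, h₁, h₂, h₃⟩
      · exact Or.inl (ih.tail h)
      · exact Or.inr ⟨d, e, h₁, h₂, h₃.tail (Or.inr h)⟩

theorem mem_withPeers {P : Pattern V C} {s s' : P.SN} :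
    s' ∈ P.withPeers s ↔ P.SameClass s s' := by
  constructor
  · rintro (rfl | h)
    · exact .refl
    · exact h.2
  · intro h
    by_cases hs : s' = s
    · exact Or.inl hs
    · exact Or.inr ⟨Ne.symm hs, h⟩

theorem Reach.sameClass {P : Pattern V C} {a b : P.SN} (h : P.Reach a b) (h' : ¬ P.Master a b) :
    P.SameClass a b := (reach_iff.1 h).resolve_right h'

theorem Master.trans_reach {P : Pattern V C} {a b c : P.SN} (h : P.Master a b) (h' : P.Reach b c) :
    P.Master a c := by
  obtain ⟨d, e, h₁, h₂, h₃⟩ := h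
  exact ⟨d, e, h₁, h₂, h₃.trans h'⟩

theorem Reach.trans_master {P : Pattern V C} {a b c : P.SN} (h : P.Reach a b) (h' : P.Master b c) :
    P.Master a c := by
  obtain ⟨d, e, h₁, h₂, h₃⟩ := h'
  exact ⟨d, e, h.trans h₁, h₂, h₃⟩

theorem Reach.inl_join {P Q : Pattern V C} {a b : P.SN} (h : P.Reach a b) :
    (join P Q).Reach (Sum.inl a) (Sum.inl b) :=
  Relation.ReflTransGen.lift (Sum.inl : P.SN → (join P Q).SN) (fun _ _ h => h) _ _ h

theorem Reach.inr_join {P Q : Pattern V C} {a b : Q.SN} (h : Q.Reach a b) :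
    (join P Q).Reach (Sum.inr a) (Sum.inr b) :=
  Relation.ReflTransGen.lift (Sum.inr : Q.SN → (join P Q).SN) (fun _ _ h => h) _ _ h

theorem Reach.inl_opt {P Q : Pattern V C} {a b : P.SN} (h : P.Reach a b) :
    (opt P Q).Reach (Sum.inl a) (Sum.inl b) :=
  Relation.ReflTransGen.lift (Sum.inl : P.SN → (opt P Q).SN) (fun _ _ h => h) _ _ h

theorem Reach.inr_opt {P Q : Pattern V C} {a b : Q.SN} (h : Q.Reach a b) :
    (opt P Q).Reach (Sum.inr a) (Sum.inr b) :=
  Relation.ReflTransGen.lift (Sum.inr : Q.SN → (opt P Q).SN) (fun _ _ h => h) _ _ h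

theorem SameClass.inl_join {P Q : Pattern V C} {a b : P.SN} (h : P.SameClass a b) :
    (join P Q).SameClass (Sum.inl a) (Sum.inl b) :=
  Relation.ReflTransGen.lift (Sum.inl : P.SN → (join P Q).SN) (fun _ _ h => h) _ _ h

theorem SameClass.inr_join {P Q : Pattern V C} {a b : Q.SN} (h : Q.SameClass a b) :
    (join P Q).SameClass (Sum.inr a) (Sum.inr b) :=
  Relation.ReflTransGen.lift (Sum.inr : Q.SN → (join P Q).SN) (fun _ _ h => h) _ _ h

theorem SameClass.inl_opt {P Q : Pattern V C} {a b : P.SN} (h : P.SameClass a b) :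
    (opt P Q).SameClass (Sum.inl a) (Sum.inl b) :=
  Relation.ReflTransGen.lift (Sum.inl : P.SN → (opt P Q).SN) (fun _ _ h => h) _ _ h

theorem SameClass.inr_opt {P Q : Pattern V C} {a b : Q.SN} (h : Q.SameClass a b) :
    (opt P Q).SameClass (Sum.inr a) (Sum.inr b) :=
  Relation.ReflTransGen.lift (Sum.inr : Q.SN → (opt P Q).SN) (fun _ _ h => h) _ _ h

theorem leftmost_reach : ∀ (P : Pattern V C) (s : P.SN), P.Reach P.leftmost s
  | bgp _ _, () => .refl
  | join P _, Sum.inl s => (leftmost_reach P s).inl_join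
  | join P Q, Sum.inr s =>
    .head (b := (Sum.inr Q.leftmost : (join P Q).SN)) (Or.inr ⟨rfl, rfl⟩)
      (leftmost_reach Q s).inr_join
  | opt P _, Sum.inl s => (leftmost_reach P s).inl_opt
  | opt P Q, Sum.inr s =>
    .head (b := (Sum.inr Q.leftmost : (opt P Q).SN)) (Or.inl ⟨rfl, rfl⟩)
      (leftmost_reach Q s).inr_opt

theorem not_slave_iff {P : Pattern V C} {s : P.SN} : ¬ P.Slave s ↔ P.AbsoluteMaster s :=
  not_exists

theorem absoluteMaster_iff_sameClass {P : Pattern V C} {s : P.SN} :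
    P.AbsoluteMaster s ↔ P.SameClass P.leftmost s := by
  refine ⟨fun h => (P.leftmost_reach s).sameClass (h _), fun h a ha => ?_⟩
  have := h.depth_eq
  have := ha.depth_lt
  simp_all

theorem sameClass_rep (P : Pattern V C) : ∀ s, P.SameClass (P.rep s) s := by
  induction P with
  | bgp n t => exact fun _ => .refl
  | join P Q ihP ihQ =>
    rintro (s | s)
    · exact (ihP s).inl_join
    · by_cases h : Q.rep s = Q.leftmost
      · have h' := ihQ s
        rw [h] at h'
        have : (join P Q).rep (Sum.inr s) = Sum.inl P.leftmost := by simp [rep, h]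
        rw [this]
        exact .head (b := (Sum.inr Q.leftmost : (join P Q).SN)) ⟨rfl, rfl⟩ h'.inr_join
      · have : (join P Q).rep (Sum.inr s) = Sum.inr (Q.rep s) := by simp [rep, h]
        rw [this]
        exact (ihQ s).inr_join
  | opt P Q ihP ihQ =>
    rintro (s | s)
    · exact (ihP s).inl_opt
    · exact (ihQ s).inr_opt

/-- The masters of a slave supernode are the supernodes that reach its parent: a peer class is
entered by at most one unidirectional edge. -/
theorem exists_parent {P : Pattern V C} {s : P.SN} (hs : P.Slave s) :
    ∃ c, P.Master c s ∧ ∀ x, P.Master x s ↔ P.Reach x c := by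
  have key : ∀ x, P.Master x s → ∃ c, P.Reach x c ∧ P.Uni c (P.rep s) := by
    rintro x ⟨c, d, h₁, h₂, h₃⟩
    replace h₃ : P.Reach d s := h₃
    clear hs
    induction h₃ with
    | refl => exact ⟨c, h₁, by rwa [rep_uni P h₂]⟩
    | @tail a b hab h ih =>
      rcases h with h | h
      · exact ⟨a, (h₁.tail (Or.inl h₂)).trans hab, by rwa [rep_uni P h]⟩
      · rwa [← rep_bi P h]
  obtain ⟨x, hx⟩ := hs
  obtain ⟨c, -, hc⟩ := key x hx
  have hcs : P.Master c s := ⟨c, _, .refl, hc, (P.sameClass_rep s).reach⟩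
  refine ⟨c, hcs, fun y => ⟨fun hy => ?_, fun hy => hy.trans_master hcs⟩⟩
  obtain ⟨c', hyc, hc'⟩ := key y hy
  rwa [uni_left_unique P hc hc']

/-! ### Where a well-designed query repeats a variable -/

/-- A variable of a well-designed pattern that also occurs outside it occurs in the peer class of
the leftmost supernode, hence is never NULL. -/
theorem exists_leftmost_of_mem_out : ∀ (P : Pattern V C) {out : Set V}, P.WellDesignedIn out →
    ∀ v ∈ P.vars, v ∈ out → ∃ i, P.SameClass P.leftmost (P.sn i) ∧ v ∈ P.tpVars i
  | bgp _ _, _, _, _, ⟨i, hi⟩, _ => ⟨i, .refl, hi⟩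
  | join P Q, out, ⟨h, h'⟩, v, ⟨i, hi⟩, hv => by
    rcases i with i | i
    · obtain ⟨k, hk, hk'⟩ := exists_leftmost_of_mem_out P h v ⟨i, hi⟩ (Or.inl hv)
      exact ⟨Sum.inl k, hk.inl_join, hk'⟩
    · obtain ⟨k, hk, hk'⟩ := exists_leftmost_of_mem_out Q h' v ⟨i, hi⟩ (Or.inl hv)
      exact ⟨Sum.inr k,
        .head (b := (Sum.inr Q.leftmost : (join P Q).SN)) ⟨rfl, rfl⟩ hk.inr_join, hk'⟩
  | opt P Q, out, ⟨h, h', _⟩, v, ⟨i, hi⟩, hv => by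
    have hP : v ∈ P.vars := by
      rcases i with i | i
      · exact ⟨i, hi⟩
      · exact h v ⟨i, hi⟩ hv
    obtain ⟨k, hk, hk'⟩ := exists_leftmost_of_mem_out P h' v hP (Or.inl hv)
    exact ⟨Sum.inl k, hk.inl_opt, hk'⟩

theorem reach_inl_join {P Q : Pattern V C} {d : P.SN} (hd : 0 < P.depth d) {z : (join P Q).SN}
    (h : (join P Q).Reach (Sum.inl d) z) : ∃ b, z = Sum.inl b ∧ P.Reach d b := by
  induction h with
  | refl => exact ⟨d, rfl, .refl⟩
  | @tail y z _ h ih =>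
    obtain ⟨b, rfl, hb⟩ := ih
    rcases z with z | z
    · exact ⟨z, rfl, hb.tail h⟩
    · rcases h with h | ⟨h, -⟩
      · exact h.elim
      · have := hb.depth_le
        simp [h] at this
        omega

theorem reach_inr_join {P Q : Pattern V C} {d : Q.SN} (hd : 0 < Q.depth d) {z : (join P Q).SN}
    (h : (join P Q).Reach (Sum.inr d) z) : ∃ b, z = Sum.inr b ∧ Q.Reach d b := by
  induction h with
  | refl => exact ⟨d, rfl, .refl⟩
  | @tail y z _ h ih =>
    obtain ⟨b, rfl, hb⟩ := ih
    rcases z with z | z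
    · rcases h with h | ⟨-, h⟩
      · exact h.elim
      · have := hb.depth_le
        simp [h] at this
        omega
    · exact ⟨z, rfl, hb.tail h⟩

theorem reach_inl_opt {P Q : Pattern V C} {d : P.SN} (hd : 0 < P.depth d) {z : (opt P Q).SN}
    (h : (opt P Q).Reach (Sum.inl d) z) : ∃ b, z = Sum.inl b ∧ P.Reach d b := by
  induction h with
  | refl => exact ⟨d, rfl, .refl⟩
  | @tail y z _ h ih =>
    obtain ⟨b, rfl, hb⟩ := ih
    rcases z with z | z
    · exact ⟨z, rfl, hb.tail h⟩
    · rcases h with ⟨h, -⟩ | h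
      · have := hb.depth_le
        simp [h] at this
        omega
      · exact h.elim

theorem reach_inr_opt {P Q : Pattern V C} {d : Q.SN} {z : (opt P Q).SN}
    (h : (opt P Q).Reach (Sum.inr d) z) : ∃ b, z = Sum.inr b ∧ Q.Reach d b := by
  induction h with
  | refl => exact ⟨d, rfl, .refl⟩
  | @tail y z _ h ih =>
    obtain ⟨b, rfl, hb⟩ := ih
    rcases z with z | z
    · exact (h.elim id id : False).elim
    · exact ⟨z, rfl, hb.tail h⟩

theorem uni_depth_pos {P : Pattern V C} {c d : P.SN} (h : P.Uni c d) : 0 < P.depth d := by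
  rw [depth_uni P h]
  omega

/-- Running intersection: a variable that occurs both below and not below a unidirectional edge
occurs in the peer class from which this edge starts. -/
theorem exists_sameClass_of_uni : ∀ (P : Pattern V C) {out : Set V}, P.WellDesignedIn out →
    ∀ {c d : P.SN}, P.Uni c d → ∀ (v : V) (b : P.Occ), P.Reach d (P.sn b) → v ∈ P.tpVars b →
    (v ∈ out ∨ ∃ a, ¬ P.Reach d (P.sn a) ∧ v ∈ P.tpVars a) →
    ∃ i, P.SameClass c (P.sn i) ∧ v ∈ P.tpVars i
  | bgp _ _, _, _, _, _, hu, _, _, _, _, _ => hu.elim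
  | join P Q, out, ⟨h, h'⟩, Sum.inl c, Sum.inl d, hu, v, b, hb, hv, ho => by
    have hu : P.Uni c d := hu
    obtain ⟨_, hb, hdb⟩ := reach_inl_join (uni_depth_pos hu) hb
    rcases b with b | b <;> cases hb
    obtain ⟨i, hi, hvi⟩ := exists_sameClass_of_uni P h hu v b hdb hv (by
      rcases ho with ho | ⟨a | a, ha, hva⟩
      · exact Or.inl (Or.inl ho)
      · exact Or.inr ⟨a, fun hr => ha hr.inl_join, hva⟩
      · exact Or.inl (Or.inr ⟨a, hva⟩))
    exact ⟨Sum.inl i, hi.inl_join, hvi⟩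
  | join P Q, out, ⟨h, h'⟩, Sum.inr c, Sum.inr d, hu, v, b, hb, hv, ho => by
    have hu : Q.Uni c d := hu
    obtain ⟨_, hb, hdb⟩ := reach_inr_join (uni_depth_pos hu) hb
    rcases b with b | b <;> cases hb
    obtain ⟨i, hi, hvi⟩ := exists_sameClass_of_uni Q h' hu v b hdb hv (by
      rcases ho with ho | ⟨a | a, ha, hva⟩
      · exact Or.inl (Or.inl ho)
      · exact Or.inl (Or.inr ⟨a, hva⟩)
      · exact Or.inr ⟨a, fun hr => ha hr.inr_join, hva⟩)
    exact ⟨Sum.inr i, hi.inr_join, hvi⟩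
  | join P Q, _, _, Sum.inl _, Sum.inr _, hu, _, _, _, _, _ => hu.elim
  | join P Q, _, _, Sum.inr _, Sum.inl _, hu, _, _, _, _, _ => hu.elim
  | opt P Q, out, ⟨_, h, _⟩, Sum.inl c, Sum.inl d, hu, v, b, hb, hv, ho => by
    have hu : P.Uni c d := hu
    obtain ⟨_, hb, hdb⟩ := reach_inl_opt (uni_depth_pos hu) hb
    rcases b with b | b <;> cases hb
    obtain ⟨i, hi, hvi⟩ := exists_sameClass_of_uni P h hu v b hdb hv (by
      rcases ho with ho | ⟨a | a, ha, hva⟩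
      · exact Or.inl (Or.inl ho)
      · exact Or.inr ⟨a, fun hr => ha hr.inl_opt, hva⟩
      · exact Or.inl (Or.inr ⟨a, hva⟩))
    exact ⟨Sum.inl i, hi.inl_opt, hvi⟩
  | opt P Q, out, ⟨_, _, h'⟩, Sum.inr c, Sum.inr d, hu, v, b, hb, hv, ho => by
    have hu : Q.Uni c d := hu
    obtain ⟨_, hb, hdb⟩ := reach_inr_opt hb
    rcases b with b | b <;> cases hb
    obtain ⟨i, hi, hvi⟩ := exists_sameClass_of_uni Q h' hu v b hdb hv (by
      rcases ho with ho | ⟨a | a, ha, hva⟩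
      · exact Or.inl (Or.inl ho)
      · exact Or.inl (Or.inr ⟨a, hva⟩)
      · exact Or.inr ⟨a, fun hr => ha hr.inr_opt, hva⟩)
    exact ⟨Sum.inr i, hi.inr_opt, hvi⟩
  | opt P Q, out, ⟨hwd, h, _⟩, Sum.inl c, Sum.inr d, hu, v, b, hb, hv, ho => by
    obtain ⟨rfl, rfl⟩ := hu
    obtain ⟨_, hb, hdb⟩ := reach_inr_opt hb
    rcases b with b | b <;> cases hb
    have hvQ : v ∈ Q.vars := ⟨b, hv⟩
    have hvP : v ∈ P.vars := by
      rcases ho with ho | ⟨a | a, ha, hva⟩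
      · exact hwd v hvQ ho
      · exact ⟨a, hva⟩
      · exact (ha (leftmost_reach Q _).inr_opt).elim
    obtain ⟨i, hi, hvi⟩ := exists_leftmost_of_mem_out P h v hvP (Or.inr hvQ)
    exact ⟨Sum.inl i, hi.inl_opt, hvi⟩
  | opt P Q, _, _, Sum.inr _, Sum.inl _, hu, _, _, _, _, _ => hu.elim

end Pattern

variable {V C : Type*}

namespace TriplePattern

theorem binds_inst {p : TriplePattern V C} {μ : V → C} {v : V} {c : C} :
    p.Binds (p.inst μ) v c ↔ v ∈ p.vars ∧ μ v = c := by
  constructor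
  · rintro ⟨k, hk, h⟩
    refine ⟨⟨k, hk⟩, ?_⟩
    simpa [inst, hk] using h
  · rintro ⟨⟨k, hk⟩, rfl⟩
    exact ⟨k, hk, by simp [inst, hk]⟩

theorem Matches.binds_unique {p : TriplePattern V C} {t : Triple C} (h : p.Matches t) {v : V}
    {c d : C} (hc : p.Binds t v c) (hd : p.Binds t v d) : c = d := by
  obtain ⟨μ, rfl⟩ := h
  exact (binds_inst.1 hc).2.symm.trans (binds_inst.1 hd).2

theorem Matches.exists_binds {p : TriplePattern V C} {t : Triple C} (h : p.Matches t) {v : V}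
    (hv : v ∈ p.vars) : ∃ c, p.Binds t v c := by
  obtain ⟨μ, rfl⟩ := h
  exact ⟨μ v, binds_inst.2 ⟨hv, rfl⟩⟩

theorem Binds.mem_vars {p : TriplePattern V C} {t : Triple C} {v : V} {c : C}
    (h : p.Binds t v c) : v ∈ p.vars := by
  obtain ⟨k, hk, -⟩ := h
  exact ⟨k, hk⟩

theorem inst_congr {p : TriplePattern V C} {μ ν : V → C} (h : ∀ v ∈ p.vars, μ v = ν v) :
    p.inst μ = p.inst ν := by
  funext k
  unfold inst
  split
  · exact h _ ⟨k, by assumption⟩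
  · rfl

end TriplePattern

namespace Pattern

/-! ### Final results -/

theorem rowBinds_sumElim_join {P Q : Pattern V C} {r : P.Row} {s : Q.Row} {v : V} {c : C} :
    (join P Q).RowBinds (Sum.elim r s) v c ↔ P.RowBinds r v c ∨ Q.RowBinds s v c := by
  constructor
  · rintro ⟨i | i, t, h, hb⟩
    · exact Or.inl ⟨i, t, h, hb⟩
    · exact Or.inr ⟨i, t, h, hb⟩
  · rintro (⟨i, t, h, hb⟩ | ⟨i, t, h, hb⟩)
    · exact ⟨Sum.inl i, t, h, hb⟩
    · exact ⟨Sum.inr i, t, h, hb⟩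

theorem rowBinds_sumElim_opt {P Q : Pattern V C} {r : P.Row} {s : Q.Row} {v : V} {c : C} :
    (opt P Q).RowBinds (Sum.elim r s) v c ↔ P.RowBinds r v c ∨ Q.RowBinds s v c :=
  rowBinds_sumElim_join (P := P) (Q := Q)

theorem not_rowBinds_none {P : Pattern V C} {v : V} {c : C} :
    ¬ P.RowBinds (fun _ => none) v c := by
  rintro ⟨i, t, h, -⟩
  cases h

theorem rowBinds_unique {D : Set (Triple C)} : ∀ (P : Pattern V C) {r : P.Row}, r ∈ P.eval D →
    ∀ {v : V} {c d : C}, P.RowBinds r v c → P.RowBinds r v d → c = d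
  | bgp n t, r, ⟨μ, h⟩, v, c, d, ⟨i, ti, hi, hc⟩, ⟨k, tk, hk, hd⟩ => by
    rw [(h i).2] at hi
    rw [(h k).2] at hk
    cases hi
    cases hk
    exact (TriplePattern.binds_inst.1 hc).2.symm.trans (TriplePattern.binds_inst.1 hd).2
  | join P Q, _, ⟨r, hr, s, hs, hrs, h⟩, v, c, d, hc, hd => by
    subst h
    rw [rowBinds_sumElim_join] at hc hd
    rcases hc with hc | hc <;> rcases hd with hd | hd
    · exact rowBinds_unique P hr hc hd
    · exact hrs v c d hc hd
    · exact (hrs v d c hd hc).symm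
    · exact rowBinds_unique Q hs hc hd
  | opt P Q, _, Or.inl ⟨r, hr, s, hs, hrs, h⟩, v, c, d, hc, hd => by
    subst h
    rw [rowBinds_sumElim_opt] at hc hd
    rcases hc with hc | hc <;> rcases hd with hd | hd
    · exact rowBinds_unique P hr hc hd
    · exact hrs v c d hc hd
    · exact (hrs v d c hd hc).symm
    · exact rowBinds_unique Q hs hc hd
  | opt P Q, _, Or.inr ⟨r, hr, _, h⟩, v, c, d, hc, hd => by
    subst h
    rw [rowBinds_sumElim_opt] at hc hd
    exact rowBinds_unique P hr (hc.resolve_right not_rowBinds_none)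
      (hd.resolve_right not_rowBinds_none)

theorem mem_matchingTriples_of_mem_eval {D : Set (Triple C)} : ∀ (P : Pattern V C) {r : P.Row},
    r ∈ P.eval D → ∀ {i : P.Occ} {t : Triple C}, r i = some t → t ∈ P.matchingTriples D i
  | bgp n p, r, ⟨μ, h⟩, i, t, hi => by
    rw [(h i).2] at hi
    cases hi
    exact ⟨(h i).1, μ, rfl⟩
  | join P Q, _, ⟨r, hr, s, hs, _, h⟩, i, t, hi => by
    subst h
    rcases i with i | i
    · exact mem_matchingTriples_of_mem_eval P hr hi
    · exact mem_matchingTriples_of_mem_eval Q hs hi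
  | opt P Q, _, Or.inl ⟨r, hr, s, hs, _, h⟩, i, t, hi => by
    subst h
    rcases i with i | i
    · exact mem_matchingTriples_of_mem_eval P hr hi
    · exact mem_matchingTriples_of_mem_eval Q hs hi
  | opt P Q, _, Or.inr ⟨r, hr, _, h⟩, i, t, hi => by
    subst h
    rcases i with i | i
    · exact mem_matchingTriples_of_mem_eval P hr hi
    · cases hi

/-- The supernodes that are matched in a final result contain the leftmost one, and with every
supernode its peers and masters. -/
theorem exists_matched {D : Set (Triple C)} : ∀ (P : Pattern V C) {r : P.Row}, r ∈ P.eval D →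
    ∃ N : Set P.SN, (∀ i, r i ≠ none ↔ P.sn i ∈ N) ∧ P.leftmost ∈ N ∧
      ∀ a b, P.Edge a b → b ∈ N → a ∈ N
  | bgp n t, r, ⟨μ, h⟩ => ⟨Set.univ, fun i => by simp [(h i).2], trivial, fun _ _ _ _ => trivial⟩
  | join P Q, _, ⟨r, hr, s, hs, _, h⟩ => by
    subst h
    obtain ⟨M, hM, hM', hM''⟩ := exists_matched P hr
    obtain ⟨N, hN, hN', hN''⟩ := exists_matched Q hs
    refine ⟨{x | Sum.elim (· ∈ M) (· ∈ N) x}, ?_, hM', ?_⟩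
    · rintro (i | i)
      · exact hM i
      · exact hN i
    · rintro (a | a) (b | b) h hb
      · exact hM'' a b h hb
      · rcases h with h | ⟨rfl, -⟩
        · exact h.elim
        · exact hM'
      · rcases h with h | ⟨-, rfl⟩
        · exact h.elim
        · exact hN'
      · exact hN'' a b h hb
  | opt P Q, _, Or.inl ⟨r, hr, s, hs, _, h⟩ => by
    subst h
    obtain ⟨M, hM, hM', hM''⟩ := exists_matched P hr
    obtain ⟨N, hN, hN', hN''⟩ := exists_matched Q hs
    refine ⟨{x | Sum.elim (· ∈ M) (· ∈ N) x}, ?_, hM', ?_⟩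
    · rintro (i | i)
      · exact hM i
      · exact hN i
    · rintro (a | a) (b | b) h hb
      · exact hM'' a b h hb
      · rcases h with ⟨rfl, -⟩ | h
        · exact hM'
        · exact h.elim
      · exact (h.elim id id : False).elim
      · exact hN'' a b h hb
  | opt P Q, _, Or.inr ⟨r, hr, _, h⟩ => by
    subst h
    obtain ⟨M, hM, hM', hM''⟩ := exists_matched P hr
    refine ⟨{x | Sum.elim (· ∈ M) (fun _ => False) x}, ?_, hM', ?_⟩
    · rintro (i | i)
      · exact hM i
      · exact ⟨fun h => h rfl, fun h => h.elim⟩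
    · rintro (a | a) (b | b) h hb
      · exact hM'' a b h hb
      · exact hb.elim
      · exact (h.elim id id : False).elim
      · exact hb.elim

theorem mem_of_reach {P : Pattern V C} {N : Set P.SN}
    (hN : ∀ a b, P.Edge a b → b ∈ N → a ∈ N) {a b : P.SN} (h : P.Reach a b) (hb : b ∈ N) :
    a ∈ N := by
  induction h using Relation.ReflTransGen.head_induction_on with
  | refl => exact hb
  | head h _ ih => exact hN _ _ h ih

theorem ne_none_of_reach {D : Set (Triple C)} {P : Pattern V C} {r : P.Row} (hr : r ∈ P.eval D)
    {i k : P.Occ} (h : P.Reach (P.sn k) (P.sn i)) (hi : r i ≠ none) : r k ≠ none := by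
  obtain ⟨N, hN, -, hN'⟩ := exists_matched P hr
  rw [hN] at hi ⊢
  exact mem_of_reach hN' h hi

/-- A variable that occurs outside a well-designed pattern is bound in the results that extend a
partial match `μ` to its value under `μ`, because it occurs next to the leftmost supernode. -/
theorem rowBinds_eq_of_mem_out {D : Set (Triple C)} {P : Pattern V C} {out : Set V}
    (hwd : P.WellDesignedIn out) {μ : V → C} {N : Set P.SN} (hl : P.leftmost ∈ N)
    (hN : ∀ a b, P.Edge a b → b ∈ N → a ∈ N) {r : P.Row} (hr : r ∈ P.eval D)
    (hrμ : ∀ i, P.sn i ∈ N → r i = some ((P.tp i).inst μ)) {v : V} {c : C}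
    (hv : v ∈ out) (hc : P.RowBinds r v c) : c = μ v := by
  obtain ⟨i, hi, hvi⟩ := exists_leftmost_of_mem_out P hwd v
    (by obtain ⟨k, t, -, hb⟩ := hc; exact ⟨k, hb.mem_vars⟩) hv
  exact rowBinds_unique P hr hc
    ⟨i, _, hrμ i (mem_of_reach hN hi.symm.reach hl), TriplePattern.binds_inst.2 ⟨hvi, rfl⟩⟩

theorem RowBinds.mem_vars {P : Pattern V C} {r : P.Row} {v : V} {c : C} (h : P.RowBinds r v c) :
    v ∈ P.vars := by
  obtain ⟨k, t, -, hb⟩ := h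
  exact ⟨k, hb.mem_vars⟩

/-- In a well-designed query, a match of the leftmost supernode and of further supernodes,
containing the peers and masters of each of them, extends to a final result. -/
theorem exists_mem_eval {D : Set (Triple C)} (μ : V → C) : ∀ (P : Pattern V C) {out : Set V},
    P.WellDesignedIn out → ∀ N : Set P.SN, P.leftmost ∈ N →
    (∀ a b, P.Edge a b → b ∈ N → a ∈ N) → (∀ i, P.sn i ∈ N → (P.tp i).inst μ ∈ D) →
    ∃ r ∈ P.eval D, ∀ i, P.sn i ∈ N → r i = some ((P.tp i).inst μ)
  | bgp n t, _, _, N, hl, _, hD => ⟨_, ⟨μ, fun i => ⟨hD i hl, rfl⟩⟩, fun _ _ => rfl⟩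
  | join P Q, out, ⟨hP, hQ⟩, N, hl, hN, hD => by
    have hl' : (Sum.inr Q.leftmost : (join P Q).SN) ∈ N :=
      hN _ (Sum.inl P.leftmost) (Or.inr ⟨rfl, rfl⟩) hl
    have hNP : ∀ a b, P.Edge a b → b ∈ {x | Sum.inl x ∈ N} → a ∈ {x | Sum.inl x ∈ N} :=
      fun a b h hb => hN (Sum.inl a) (Sum.inl b) h hb
    have hNQ : ∀ a b, Q.Edge a b → b ∈ {x | Sum.inr x ∈ N} → a ∈ {x | Sum.inr x ∈ N} :=
      fun a b h hb => hN (Sum.inr a) (Sum.inr b) h hb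
    obtain ⟨r, hr, hr'⟩ := exists_mem_eval μ P hP {x | Sum.inl x ∈ N} hl hNP
      (fun i hi => hD (Sum.inl i) hi)
    obtain ⟨s, hs, hs'⟩ := exists_mem_eval μ Q hQ {x | Sum.inr x ∈ N} hl' hNQ
      (fun i hi => hD (Sum.inr i) hi)
    refine ⟨_, ⟨r, hr, s, hs, fun v c d hc hd => ?_, rfl⟩, ?_⟩
    · rw [rowBinds_eq_of_mem_out hP hl hNP hr hr' (Or.inr hd.mem_vars) hc,
        rowBinds_eq_of_mem_out hQ hl' hNQ hs hs' (Or.inr hc.mem_vars) hd]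
    · rintro (i | i) hi
      · exact hr' i hi
      · exact hs' i hi
  | opt P Q, out, ⟨_, hP, hQ⟩, N, hl, hN, hD => by
    have hNP : ∀ a b, P.Edge a b → b ∈ {x | Sum.inl x ∈ N} → a ∈ {x | Sum.inl x ∈ N} :=
      fun a b h hb => hN (Sum.inl a) (Sum.inl b) h hb
    have hNQ : ∀ a b, Q.Edge a b → b ∈ {x | Sum.inr x ∈ N} → a ∈ {x | Sum.inr x ∈ N} :=
      fun a b h hb => hN (Sum.inr a) (Sum.inr b) h hb
    obtain ⟨r, hr, hr'⟩ := exists_mem_eval μ P hP {x | Sum.inl x ∈ N} hl hNP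
      (fun i hi => hD (Sum.inl i) hi)
    by_cases hl' : (Sum.inr Q.leftmost : (opt P Q).SN) ∈ N
    · obtain ⟨s, hs, hs'⟩ := exists_mem_eval μ Q hQ {x | Sum.inr x ∈ N} hl' hNQ
        (fun i hi => hD (Sum.inr i) hi)
      refine ⟨_, Or.inl ⟨r, hr, s, hs, fun v c d hc hd => ?_, rfl⟩, ?_⟩
      · rw [rowBinds_eq_of_mem_out hP hl hNP hr hr' (Or.inr hd.mem_vars) hc,
          rowBinds_eq_of_mem_out hQ hl' hNQ hs hs' (Or.inr hc.mem_vars) hd]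
      · rintro (i | i) hi
        · exact hr' i hi
        · exact hs' i hi
    · have hout : ∀ x : Q.SN, (Sum.inr x : (opt P Q).SN) ∉ N :=
        fun x hx => hl' (mem_of_reach hNQ (leftmost_reach Q x) hx)
      by_cases hc : ∃ s ∈ Q.eval D, Compatible P Q r s
      · obtain ⟨s, hs, hrs⟩ := hc
        refine ⟨_, Or.inl ⟨r, hr, s, hs, hrs, rfl⟩, ?_⟩
        rintro (i | i) hi
        · exact hr' i hi
        · exact (hout _ hi).elim
      · refine ⟨_, Or.inr ⟨r, hr, fun s hs hrs => hc ⟨s, hs, hrs⟩, rfl⟩, ?_⟩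
        rintro (i | i) hi
        · exact hr' i hi
        · exact (hout _ hi).elim

/-! ### One round of semi-joins -/

/-- The value that the triple `t` of the TP `k` gives to `j` occurs in all TPs with `j` in the
supernode of `k`, its peers and its masters. -/
def Supported (P : Pattern V C) (Δ : P.State) (j : V) (k : P.Occ) (t : Triple C) : Prop :=
  ∀ c, (P.tp k).Binds t j c → ∀ a, P.Reach (P.sn a) (P.sn k) → j ∈ P.tpVars a → c ∈ P.proj Δ a j

/-- The joint effect of all semi-joins and clustered-semi-joins on `j`: the supported triples are
kept. -/
def step (P : Pattern V C) (j : V) (Δ : P.State) : P.State :=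
  fun k => {t ∈ Δ k | P.Supported Δ j k t}

/-- Every triple is a match of its TP. -/
def Matched (P : Pattern V C) (Δ : P.State) : Prop := ∀ k, ∀ t ∈ Δ k, (P.tp k).Matches t

theorem proj_mono {P : Pattern V C} {Δ Δ' : P.State} (h : Δ ≤ Δ') (i : P.Occ) (j : V) :
    P.proj Δ i j ⊆ P.proj Δ' i j := fun _ ⟨t, ht, hb⟩ => ⟨t, h i ht, hb⟩

theorem Matched.mono {P : Pattern V C} {Δ Δ' : P.State} (h : Δ ≤ Δ') (hΔ : P.Matched Δ') :
    P.Matched Δ := fun k t ht => hΔ k t (h k ht)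

theorem step_le (P : Pattern V C) (j : V) (Δ : P.State) : P.step j Δ ≤ Δ := fun _ _ h => h.1

theorem semiJoin_le (P : Pattern V C) (j : V) (b a : P.Occ) (Δ : P.State) :
    P.semiJoin j b a Δ ≤ Δ := fun _ _ h => h.1

theorem clusteredSemiJoin_le (P : Pattern V C) (j : V) (S : Set P.Occ) (Δ : P.State) :
    P.clusteredSemiJoin j S Δ ≤ Δ := fun _ _ h => h.1

/-- Supported triples support each other, so they remain supported after the step. -/
theorem mem_proj_step {P : Pattern V C} {Δ : P.State} (hΔ : P.Matched Δ) {j : V} {k : P.Occ}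
    {t : Triple C} (h : P.Supported Δ j k t) {c : C} (hc : (P.tp k).Binds t j c) {a : P.Occ}
    (ha : P.Reach (P.sn a) (P.sn k)) (hja : j ∈ P.tpVars a) : c ∈ P.proj (P.step j Δ) a j := by
  obtain ⟨t', ht', hc'⟩ := h c hc a ha hja
  refine ⟨t', ⟨ht', fun d hd b hb hjb => ?_⟩, hc'⟩
  rw [(hΔ a t' ht').binds_unique hd hc']
  exact h c hc b (hb.trans ha) hjb

theorem foldl_le {ι S : Type*} [Preorder S] {f : S → ι → S} (hf : ∀ s x, f s x ≤ s) :
    ∀ (l : List ι) (s : S), l.foldl f s ≤ s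
  | [], _ => le_rfl
  | x :: l, s => (foldl_le hf l (f s x)).trans (hf s x)

/-- In a loop of decreasing operations, each operation is applied to a state below the first one
and above the last one. -/
theorem exists_foldl_le {ι S : Type*} [Preorder S] {f : S → ι → S} (hf : ∀ s x, f s x ≤ s) {x : ι} :
    ∀ (l : List ι) (s : S), x ∈ l → ∃ s' ≤ s, l.foldl f s ≤ f s' x
  | y :: l, s, hx => by
    rcases List.mem_cons.1 hx with rfl | hx
    · exact ⟨s, le_rfl, foldl_le hf l _⟩
    · obtain ⟨s', hs', h⟩ := exists_foldl_le hf l (f s y) hx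
      exact ⟨s', hs'.trans (hf s y), h⟩

theorem foldl_induction {ι S : Type*} {f : S → ι → S} {p : S → Prop} (hf : ∀ s x, p s → p (f s x)) :
    ∀ (l : List ι) (s : S), p s → p (l.foldl f s)
  | [], _, h => h
  | x :: l, s, h => foldl_induction hf l (f s x) (hf s x h)

theorem semiJoinLoop_le (P : Pattern V C) (tps : List P.Occ) (j : V) (Δ : P.State) :
    P.semiJoinLoop tps j Δ ≤ Δ := by
  refine foldl_le (fun Δ a => foldl_le (fun Δ b => ?_) _ _) _ _
  split
  · exact P.semiJoin_le j b a Δ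
  · exact le_rfl

theorem clusteredLoop_le (P : Pattern V C) (sns : List P.SN) (j : V) (Δ : P.State) :
    P.clusteredLoop sns j Δ ≤ Δ := by
  refine foldl_le (fun Δ a => ?_) _ _
  split
  · exact P.clusteredSemiJoin_le _ _ Δ
  · exact le_rfl

/-- Whatever the order of the loops, all semi-joins and clustered-semi-joins on `j` together
keep exactly the supported triples. -/
theorem clusteredLoop_semiJoinLoop {P : Pattern V C} {tps : List P.Occ} (htps : ∀ i, i ∈ tps)
    {sns : List P.SN} (hsns : ∀ s, s ∈ sns) (j : V) {Δ : P.State} (hΔ : P.Matched Δ) :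
    P.clusteredLoop sns j (P.semiJoinLoop tps j Δ) = P.step j Δ := by
  refine le_antisymm ?_ ?_
  · intro k t ht
    have ht₁ := P.clusteredLoop_le _ _ _ k ht
    have ht₀ := P.semiJoinLoop_le _ _ _ k ht₁
    refine ⟨ht₀, fun c hc a ha hja => ?_⟩
    have hjk : j ∈ P.tpVars k := hc.mem_vars
    rcases reach_iff.1 ha with hak | hak
    · obtain ⟨Δ', hΔ', h⟩ := exists_foldl_le (x := P.sn k) (f := fun Δ s =>
          open Classical in
          if ∃ i, P.sn i = s ∧ j ∈ P.tpVars i then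
            P.clusteredSemiJoin j {i | j ∈ P.tpVars i ∧ P.sn i ∈ P.withPeers s} Δ
          else Δ) (fun Δ s => by
            split
            · exact P.clusteredSemiJoin_le _ _ Δ
            · exact le_rfl) sns (P.semiJoinLoop tps j Δ) (hsns _)
      have h := h k ht
      rw [if_pos ⟨k, rfl, hjk⟩] at h
      obtain ⟨d, hd, hd'⟩ := h.2 ⟨hjk, mem_withPeers.2 .refl⟩
      rw [(hΔ k t ht₀).binds_unique hc hd']
      exact proj_mono (hΔ'.trans (P.semiJoinLoop_le _ _ _)) _ _
        (hd a ⟨hja, mem_withPeers.2 hak.symm⟩)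
    · have hf : ∀ a (Δ : P.State) b, (open Classical in
          if P.Master (P.sn a) (P.sn b) ∧ j ∈ P.tpVars a ∧ j ∈ P.tpVars b then P.semiJoin j b a Δ
            else Δ) ≤ Δ := by
        intro a Δ b
        split
        · exact P.semiJoin_le j b a Δ
        · exact le_rfl
      obtain ⟨Δ', hΔ', h⟩ := exists_foldl_le (x := a) (fun Δ a => foldl_le (hf a) tps Δ) tps Δ
        (htps a)
      have h := h k ht₁
      obtain ⟨Δ'', hΔ'', h'⟩ := exists_foldl_le (x := k) (hf a) tps Δ' (htps k)
      have h := h' k h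
      rw [if_pos ⟨hak, hja, hjk⟩] at h
      obtain ⟨d, hd, hd'⟩ := h.2 rfl
      rw [(hΔ k t ht₀).binds_unique hc hd']
      exact proj_mono (hΔ''.trans hΔ') _ _ hd.1
  · refine foldl_induction (p := fun Δ' => P.step j Δ ≤ Δ') (fun Δ' s h => ?_) _ _
      (foldl_induction (p := fun Δ' => P.step j Δ ≤ Δ')
        (fun Δ' a h => foldl_induction (p := fun Δ' => P.step j Δ ≤ Δ') (fun Δ' b h => ?_) _ _ h)
        _ _ (P.step_le j Δ))
    · split
      · intro k t ht
        refine ⟨h k ht, fun hk => ?_⟩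
        obtain ⟨c, hc⟩ := (hΔ k t ht.1).exists_binds hk.1
        refine ⟨c, fun i hi => proj_mono h _ _ (mem_proj_step hΔ ht.2 hc ?_ hi.1), hc⟩
        exact ((mem_withPeers.1 hi.2).symm.reach).trans (mem_withPeers.1 hk.2).reach
      · exact h
    · split
      · rename_i hab
        intro k t ht
        refine ⟨h k ht, ?_⟩
        rintro rfl
        obtain ⟨c, hc⟩ := (hΔ k t ht.1).exists_binds hab.2.2
        exact ⟨c, ⟨proj_mono h _ _ (mem_proj_step hΔ ht.2 hc hab.1.reach hab.2.1),
          t, h k ht, hc⟩, hc⟩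
      · exact h

/-- The passes of `prune_triples`, written with the joint steps. -/
theorem prunePass_eq {P : Pattern V C} {tps : List P.Occ} (htps : ∀ i, i ∈ tps)
    {sns : List P.SN} (hsns : ∀ s, s ∈ sns) : ∀ (l : List V) {Δ : P.State}, P.Matched Δ →
    P.prunePass tps sns l Δ = l.foldl (fun Δ j => P.step j Δ) Δ
  | [], _, _ => rfl
  | j :: l, Δ, hΔ => by
    have h := prunePass_eq htps hsns l (hΔ.mono (P.step_le j Δ))
    rw [List.foldl_cons, ← h, ← clusteredLoop_semiJoinLoop htps hsns j hΔ]
    rfl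

/-- A step does not remove a triple that contributes to a final result. -/
theorem resultTriples_le_step {P : Pattern V C} {D : Set (Triple C)} {Δ : P.State}
    (h : P.resultTriples D ≤ Δ) (j : V) : P.resultTriples D ≤ P.step j Δ := by
  rintro k t ⟨r, hr, hk⟩
  refine ⟨h k ⟨r, hr, hk⟩, fun c hc a ha hja => ?_⟩
  obtain ⟨t', ht'⟩ := Option.ne_none_iff_exists'.1
    (ne_none_of_reach hr ha (by rw [hk]; exact Option.some_ne_none t))
  obtain ⟨d, hd⟩ := (mem_matchingTriples_of_mem_eval P hr ht').2.exists_binds hja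
  rw [rowBinds_unique P hr ⟨k, t, hk, hc⟩ ⟨a, t', ht', hd⟩]
  exact ⟨t', h a ⟨r, hr, ht'⟩, hd⟩

end Pattern

/-! ### Rooted subtrees of acyclic graphs -/

section Graph

variable {V : Type*} {G : SimpleGraph V} {S : Set V} {root : V}

theorem exists_mem_edges_of_isAcyclic (hG : G.IsAcyclic) {u v : V} (huv : u ≠ v)
    (w w' : G.Walk u v) : ∃ x y, s(x, y) ∈ w.edges ∧ s(x, y) ∈ w'.edges := by
  classical
  have h : w.toPath = w'.toPath := (hG.subsingleton_path u v).elim _ _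
  have hw := w.edges_toPath_subset_edges
  have hw' := w'.edges_toPath_subset_edges
  rw [← h] at hw'
  generalize (w.toPath : G.Walk u v) = p at hw hw'
  cases p with
  | nil => exact (huv rfl).elim
  | @cons _ x _ h p =>
    have hmem : s(u, x) ∈ (SimpleGraph.Walk.cons h p).edges := by simp
    exact ⟨u, x, hw hmem, hw' hmem⟩

/-- Every node of `S` is reachable from the root inside `S`. -/
def RootedIn (G : SimpleGraph V) (S : Set V) (root : V) : Prop :=
  ∀ a ∈ S, ∃ w : G.Walk root a, ∀ x ∈ w.support, x ∈ S

/-- The distance from the root inside `S`. -/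
noncomputable def treeRank (G : SimpleGraph V) (S : Set V) (root a : V) : ℕ :=
  sInf {n | ∃ w : G.Walk root a, (∀ x ∈ w.support, x ∈ S) ∧ w.length = n}

theorem ProperAncestor.treeRank_lt (hr : RootedIn G S root) {a b : V}
    (h : ProperAncestor G S root b a) : treeRank G S root b < treeRank G S root a := by
  classical
  obtain ⟨ha, hb, hne, h⟩ := h
  have hnon : {n | ∃ w : G.Walk root a, (∀ x ∈ w.support, x ∈ S) ∧ w.length = n}.Nonempty := by
    obtain ⟨w, hw⟩ := hr a ha
    exact ⟨_, w, hw, rfl⟩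
  obtain ⟨w, hw, hlen⟩ := Nat.sInf_mem hnon
  have hbw := h w hw
  have h₁ : treeRank G S root b ≤ (w.takeUntil b hbw).length :=
    Nat.sInf_le ⟨_, fun x hx => hw x (w.support_takeUntil_subset_support hbw hx), rfl⟩
  have h₂ := w.length_takeUntil_lt_length hbw hne
  unfold treeRank at h₁ ⊢
  omega

theorem ProperAncestor.ne_root {a b : V} (h : ProperAncestor G S root b a) : a ≠ root := by
  rintro rfl
  obtain ⟨ha, -, hne, h⟩ := h
  have := h .nil (by simpa using ha)
  simp at this
  exact hne this

/-- Of two adjacent nodes one is an ancestor of the other. -/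
theorem properAncestor_or_of_adj (hG : G.IsAcyclic) {a b : V} (h : G.Adj a b) (ha : a ∈ S)
    (hb : b ∈ S) : ProperAncestor G S root a b ∨ ProperAncestor G S root b a := by
  by_contra! hcon
  have h₁ : ∃ w : G.Walk root b, a ∉ w.support := by
    by_contra! hw
    exact hcon.1 ⟨hb, ha, h.ne, fun w _ => hw w⟩
  have h₂ : ∃ w : G.Walk root a, b ∉ w.support := by
    by_contra! hw
    exact hcon.2 ⟨ha, hb, h.ne', fun w _ => hw w⟩
  obtain ⟨w₁, hw₁⟩ := h₁
  obtain ⟨w₂, hw₂⟩ := h₂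
  obtain ⟨x, y, hx, hy⟩ := exists_mem_edges_of_isAcyclic hG h.ne (w₂.reverse.append w₁) h.toWalk
  simp only [SimpleGraph.Walk.edges_cons, SimpleGraph.Walk.edges_nil, List.mem_singleton,
    SimpleGraph.Adj.toWalk] at hy
  rw [hy, SimpleGraph.Walk.edges_append, List.mem_append, SimpleGraph.Walk.edges_reverse,
    List.mem_reverse] at hx
  rcases hx with hx | hx
  · exact hw₂ (w₂.snd_mem_support_of_mem_edges hx)
  · exact hw₁ (w₁.fst_mem_support_of_mem_edges hx)

/-- A node has at most one parent: of two ancestors adjacent to it, each would be an ancestor of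
the other. -/
theorem ProperAncestor.eq_of_adj (hr : RootedIn G S root) {p q c : V}
    (hp : ProperAncestor G S root p c) (hq : ProperAncestor G S root q c) (hpc : G.Adj p c)
    (hqc : G.Adj q c) : p = q := by
  by_contra hne
  have key : ∀ {p q : V}, p ≠ q → ProperAncestor G S root p c → ProperAncestor G S root q c →
      G.Adj p c → ProperAncestor G S root q p := by
    intro p q hne hp hq hpc
    refine ⟨hp.2.1, hq.2.1, hne.symm, fun w hw => ?_⟩
    have h := hq.2.2.2 (w.concat hpc) (by
      intro x hx
      rw [SimpleGraph.Walk.support_concat, List.mem_append,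
      List.mem_singleton] at hx
      rcases hx with hx | rfl
      · exact hw x hx
      · exact hp.1)
    rw [SimpleGraph.Walk.support_concat, List.mem_append,
      List.mem_singleton] at h
    exact h.resolve_right hq.2.2.1
  have h₁ := (key hne hp hq hpc).treeRank_lt hr
  have h₂ := (key (Ne.symm hne) hq hp hqc).treeRank_lt hr
  omega

theorem exists_bottomUp (hS : S.Finite) (hr : RootedIn G S root) : ∃ l, BottomUp G S root l := by
  classical
  refine ⟨hS.toFinset.toList.mergeSort
    (fun a b => decide (treeRank G S root b ≤ treeRank G S root a)), ?_, ?_, ?_⟩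
  · exact (List.mergeSort_perm _ _).nodup_iff.2 (Finset.nodup_toList _)
  · intro v
    simp
  · refine (List.pairwise_mergeSort ?_ ?_ _).imp ?_
    · intro a b c
      simp only [decide_eq_true_eq]
      omega
    · intro a b
      simp only [Bool.or_eq_true, decide_eq_true_eq]
      omega
    · intro a b h h'
      have := h'.treeRank_lt hr
      simp only [decide_eq_true_eq] at h
      omega

theorem exists_topDown (hS : S.Finite) (hr : RootedIn G S root) : ∃ l, TopDown G S root l := by
  obtain ⟨l, h₁, h₂, h₃⟩ := exists_bottomUp hS hr
  exact ⟨l.reverse, List.nodup_reverse.2 h₁, fun v => by rw [List.mem_reverse, h₂],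
    List.pairwise_reverse.2 h₃⟩

end Graph

namespace Pattern

variable {V C : Type*}

/-! ### Connected sets of triple patterns -/

/-- The TPs in `T` are connected to each other through shared variables. -/
def TpLinked (P : Pattern V C) (T : Set P.Occ) : Prop :=
  ∀ i ∈ T, ∀ k ∈ T, Relation.ReflTransGen
    (fun a b : P.Occ => a ∈ T ∧ b ∈ T ∧ (P.tpVars a ∩ P.tpVars b).Nonempty) i k

theorem Linked.tpLinked {P : Pattern V C} {A : Set P.SN} (h : P.Linked A) :
    P.TpLinked {i | P.sn i ∈ A} := fun i hi k hk => h i k hi hk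

theorem tpLinked_singleton (P : Pattern V C) (i : P.Occ) : P.TpLinked {i} := by
  rintro _ rfl _ rfl
  exact .refl

theorem TpLinked.union {P : Pattern V C} {T T' : Set P.Occ} (h : P.TpLinked T)
    (h' : P.TpLinked T') {i k : P.Occ} (hi : i ∈ T) (hk : k ∈ T')
    (hik : (P.tpVars i ∩ P.tpVars k).Nonempty) : P.TpLinked (T ∪ T') := by
  have hT : ∀ a ∈ T, ∀ b ∈ T, Relation.ReflTransGen (fun a b : P.Occ =>
      a ∈ T ∪ T' ∧ b ∈ T ∪ T' ∧ (P.tpVars a ∩ P.tpVars b).Nonempty) a b := fun a ha b hb =>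
    Relation.ReflTransGen.mono (fun _ _ h => ⟨Or.inl h.1, Or.inl h.2.1, h.2.2⟩) _ _ (h a ha b hb)
  have hT' : ∀ a ∈ T', ∀ b ∈ T', Relation.ReflTransGen (fun a b : P.Occ =>
      a ∈ T ∪ T' ∧ b ∈ T ∪ T' ∧ (P.tpVars a ∩ P.tpVars b).Nonempty) a b := fun a ha b hb =>
    Relation.ReflTransGen.mono (fun _ _ h => ⟨Or.inr h.1, Or.inr h.2.1, h.2.2⟩) _ _ (h' a ha b hb)
  rintro a (ha | ha) b (hb | hb)
  · exact hT a ha b hb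
  · exact ((hT a ha i hi).tail ⟨Or.inl hi, Or.inr hk, hik⟩).trans (hT' k hk b hb)
  · rw [Set.inter_comm] at hik
    exact ((hT' a ha k hk).tail ⟨Or.inr hk, Or.inl hi, hik⟩).trans (hT i hi b hb)
  · exact hT' a ha b hb

/-- In a connected set of TPs, two jvars are joined by a walk in the GoJ with all nodes and edges
coming from these TPs. -/
theorem TpLinked.exists_walk {P : Pattern V C} {T : Set P.Occ} (h : P.TpLinked T) {u v : V}
    (hu : P.IsJvar u) (hv : P.IsJvar v) {i k : P.Occ} (hi : i ∈ T) (hk : k ∈ T)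
    (hui : u ∈ P.tpVars i) (hvk : v ∈ P.tpVars k) :
    ∃ w : P.goj.Walk u v, (∀ x ∈ w.support, P.IsJvar x ∧ ∃ a ∈ T, x ∈ P.tpVars a) ∧
      ∀ x y, s(x, y) ∈ w.edges → ∃ a ∈ T, x ∈ P.tpVars a ∧ y ∈ P.tpVars a := by
  have hcons : ∀ (a : P.Occ), a ∈ T → ∀ x y : V, P.IsJvar x → P.IsJvar y → x ∈ P.tpVars a →
      y ∈ P.tpVars a → ∃ w : P.goj.Walk x y,
        (∀ x ∈ w.support, P.IsJvar x ∧ ∃ a ∈ T, x ∈ P.tpVars a) ∧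
        ∀ x y, s(x, y) ∈ w.edges → ∃ a ∈ T, x ∈ P.tpVars a ∧ y ∈ P.tpVars a := by
    intro a ha x y hx hy hxa hya
    by_cases hxy : x = y
    · subst hxy
      refine ⟨.nil, ?_, ?_⟩
      · intro z hz
        simp at hz
        subst hz
        exact ⟨hx, a, ha, hxa⟩
      · intro _ _ hz
        simp at hz
    · have hadj : P.goj.Adj x y := ⟨hxy, hx, hy, a, hxa, hya⟩
      refine ⟨.cons hadj .nil, ?_, ?_⟩
      · intro z hz
        simp at hz
        rcases hz with rfl | rfl
        · exact ⟨hx, a, ha, hxa⟩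
        · exact ⟨hy, a, ha, hya⟩
      · intro z z' hz
        simp at hz
        rcases hz with ⟨rfl, rfl⟩ | ⟨rfl, rfl⟩
        · exact ⟨a, ha, hxa, hya⟩
        · exact ⟨a, ha, hya, hxa⟩
  have hr := h i hi k hk
  clear hk
  induction hr generalizing v with
  | refl => exact hcons i hi u v hu hv hui hvk
  | @tail a b _ hab ih =>
    obtain ⟨ha, hb, x, hxa, hxb⟩ := hab
    by_cases hne : a = b
    · subst hne
      exact ih hv hvk
    · have hx : P.IsJvar x := ⟨a, b, hne, hxa, hxb⟩
      obtain ⟨w, hw, hw'⟩ := ih hx hxa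
      obtain ⟨w₁, hw₁, hw₁'⟩ := hcons b hb x v hx hv hxb hvk
      refine ⟨w.append w₁, fun y hy => ?_, fun y z hyz => ?_⟩
      · rw [SimpleGraph.Walk.mem_support_append_iff] at hy
        exact hy.elim (hw y) (hw₁ y)
      · rw [SimpleGraph.Walk.edges_append, List.mem_append] at hyz
        exact hyz.elim (hw' y z) (hw₁' y z)

/-- If the GoJ is acyclic, then two disjoint connected sets of TPs share at most one variable. -/
theorem GojAcyclic.eq_of_mem_of_disjoint {P : Pattern V C} (hac : P.GojAcyclic) {T T' : Set P.Occ}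
    (hT : P.TpLinked T) (hT' : P.TpLinked T') (hd : ∀ i ∈ T, i ∉ T') {u v : V}
    {i k i' k' : P.Occ} (hi : i ∈ T) (hk : k ∈ T) (hi' : i' ∈ T') (hk' : k' ∈ T')
    (hui : u ∈ P.tpVars i) (hvk : v ∈ P.tpVars k) (hui' : u ∈ P.tpVars i')
    (hvk' : v ∈ P.tpVars k') : u = v := by
  by_contra huv
  have hne : ∀ a ∈ T, ∀ b ∈ T', a ≠ b := fun a ha b hb hab => hd a ha (hab ▸ hb)
  have hu : P.IsJvar u := ⟨i, i', hne _ hi _ hi', hui, hui'⟩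
  have hv : P.IsJvar v := ⟨k, k', hne _ hk _ hk', hvk, hvk'⟩
  obtain ⟨w, -, hw⟩ := hT.exists_walk hu hv hi hk hui hvk
  obtain ⟨w', -, hw'⟩ := hT'.exists_walk hu hv hi' hk' hui' hvk'
  obtain ⟨x, y, hx, hx'⟩ := exists_mem_edges_of_isAcyclic hac.1 huv w w'
  obtain ⟨a, ha, hxa, hya⟩ := hw x y hx
  obtain ⟨b, hb, hxb, hyb⟩ := hw' x y hx'
  exact hac.2 a b (hne a ha b hb) x y (w.adj_of_mem_edges hx).ne ⟨hxa, hya, hxb, hyb⟩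

theorem Linked.rootedIn {P : Pattern V C} {A : Set P.SN} (h : P.Linked A) {root : V}
    (hr : root ∈ P.jvarsOf A) : RootedIn P.goj (P.jvarsOf A) root := by
  rintro v ⟨hv, k, hk, hvk⟩
  obtain ⟨hr, i, hi, hri⟩ := hr
  obtain ⟨w, hw, -⟩ := h.tpLinked.exists_walk hr hv hi hk hri hvk
  exact ⟨w, fun x hx => hw x hx⟩

theorem finite_vars (P : Pattern V C) : P.vars.Finite := by
  have := P.finite_occ
  have h : P.vars = ⋃ i, P.tpVars i := by
    ext v
    simp [vars]
  rw [h]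
  refine Set.finite_iUnion fun i => ?_
  refine (Set.finite_range fun k : Fin 3 => P.tp i k).preimage_embedding
    ⟨Term.var, fun a b h => by cases h; rfl⟩ |>.subset ?_
  rintro v ⟨k, hk⟩
  exact ⟨k, hk⟩

theorem finite_jvarsOf (P : Pattern V C) (A : Set P.SN) : (P.jvarsOf A).Finite :=
  P.finite_vars.subset fun _ ⟨_, i, _, hi⟩ => ⟨i, hi⟩

/-- A supernode together with all its masters and peers is connected. -/
theorem NoCartesianProducts.tpLinked_reach {P : Pattern V C} (hnc : P.NoCartesianProducts) :
    ∀ s, P.TpLinked {i | P.Reach (P.sn i) s} := by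
  intro s
  induction hn : P.depth s using Nat.strong_induction_on generalizing s with
  | _ n ih =>
    have hw := (hnc.peers s).tpLinked
    by_cases hs : P.Slave s
    · obtain ⟨c, hc, hcs⟩ := exists_parent hs
      have hc' := ih _ (hn ▸ hc.depth_lt) c rfl
      obtain ⟨v, ⟨-, i, hi, hvi⟩, -, k, hk, hvk⟩ := hnc.slaves s hs
      have h := hw.union hc' (i := i) (k := k)
        (mem_withPeers.2 (Set.mem_singleton_iff.1 hi ▸ .refl))
        ((hcs _).1 hk) ⟨v, hvi, hvk⟩
      convert h using 1
      ext a
      simp only [Set.mem_ofPred_eq, Set.mem_union, mem_withPeers, reach_iff (b := s), hcs]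
      exact or_congr_left ⟨fun h => h.symm, fun h => h.symm⟩
    · convert hw using 1
      ext a
      simp only [Set.mem_ofPred_eq, mem_withPeers]
      exact ⟨fun h => (h.sameClass fun h' => hs ⟨_, h'⟩).symm, fun h => h.symm.reach⟩

/-- The masters and peers of a slave supernode are connected without this supernode. -/
theorem NoCartesianProducts.tpLinked_reach_ne {P : Pattern V C} (hnc : P.NoCartesianProducts)
    {s : P.SN} (hs : P.Slave s) : P.TpLinked {i | P.Reach (P.sn i) s ∧ P.sn i ≠ s} := by
  obtain ⟨c, hc, hcs⟩ := exists_parent hs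
  have hM : P.TpLinked {i | P.Master (P.sn i) s} := by
    convert hnc.tpLinked_reach c using 1
    ext a
    exact hcs _
  set T := {i | P.Reach (P.sn i) s ∧ P.sn i ≠ s} with hT
  have hMT : ∀ i, P.Master (P.sn i) s → i ∈ T := fun i hi => ⟨hi.reach, by
    intro h
    have := hi.depth_lt
    rw [h] at this
    omega⟩
  -- Every TP of a peer is connected to a TP of a master, inside the peer and the masters.
  have key : ∀ a ∈ T, ∃ m, P.Master (P.sn m) s ∧ Relation.ReflTransGen
      (fun a b : P.Occ => a ∈ T ∧ b ∈ T ∧ (P.tpVars a ∩ P.tpVars b).Nonempty) a m := by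
    intro a ha
    rcases reach_iff.1 ha.1 with hp | hm
    · have hslave : P.Slave (P.sn a) := ⟨c, hc.trans_reach hp.symm.reach⟩
      obtain ⟨v, ⟨-, i, hi, hvi⟩, -, k, hk, hvk⟩ := hnc.slaves _ hslave
      have hk' : P.Master (P.sn k) s := Master.trans_reach hk ha.1
      have hsub : ∀ b, P.sn b = P.sn a → b ∈ T := fun b hb => by
        rw [hT, Set.mem_ofPred_eq, hb]
        exact ha
      refine ⟨k, hk', .tail (Relation.ReflTransGen.mono (fun x y h => ?_) _ _
        (hnc.bgps (P.sn a) a i rfl hi)) ⟨hsub i hi, hMT k hk', v, hvi, hvk⟩⟩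
      exact ⟨hsub x h.1, hsub y h.2.1, h.2.2⟩
    · exact ⟨a, hm, .refl⟩
  intro a ha b hb
  obtain ⟨m, hm, ham⟩ := key a ha
  obtain ⟨m', hm', hbm⟩ := key b hb
  have hmm := Relation.ReflTransGen.mono (fun x y h =>
    (⟨hMT x h.1, hMT y h.2.1, h.2.2⟩ : x ∈ T ∧ y ∈ T ∧ (P.tpVars x ∩ P.tpVars y).Nonempty)) _ _
    (hM m hm m' hm')
  have : Std.Symm (fun a b : P.Occ => a ∈ T ∧ b ∈ T ∧ (P.tpVars a ∩ P.tpVars b).Nonempty) :=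
    ⟨fun x y h => ⟨h.2.1, h.1, by rw [Set.inter_comm]; exact h.2.2⟩⟩
  exact (ham.trans hmm).trans (Relation.ReflTransGen.stdSymm.symm _ _ hbm)

/-! ### The effect of the two passes -/

/-- The step on `j` does not change the triples of the TP `k`: they are all supported. -/
def Stable (P : Pattern V C) (Δ : P.State) (k : P.Occ) (j : V) : Prop :=
  ∀ t ∈ Δ k, P.Supported Δ j k t

theorem stable_step_self {P : Pattern V C} {Δ : P.State} (hΔ : P.Matched Δ) (k : P.Occ) (j : V) :
    P.Stable (P.step j Δ) k j := fun _ ht _ hc _ ha hja => mem_proj_step hΔ ht.2 hc ha hja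

theorem Stable.step_apply {P : Pattern V C} {Δ : P.State} {k : P.Occ} {j : V}
    (h : P.Stable Δ k j) : P.step j Δ k = Δ k :=
  Set.Subset.antisymm (P.step_le j Δ k) fun t ht => ⟨ht, h t ht⟩

theorem stable_of_notMem {P : Pattern V C} (Δ : P.State) {k : P.Occ} {j : V}
    (h : j ∉ P.tpVars k) : P.Stable Δ k j := fun _ _ _ hc => (h hc.mem_vars).elim

theorem stable_of_not_isJvar {P : Pattern V C} (Δ : P.State) {k : P.Occ} {j : V}
    (h : ¬ P.IsJvar j) : P.Stable Δ k j := by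
  intro t ht c hc a _ hja
  have hak : a = k := by
    by_contra hne
    exact h ⟨a, k, hne, hja, hc.mem_vars⟩
  subst hak
  exact ⟨t, ht, hc⟩

/-- Stability can be lost only when the triples of another supporting TP change. -/
theorem Stable.step {P : Pattern V C} {Δ : P.State} {k : P.Occ} {c : V} (h : P.Stable Δ k c)
    (j : V) (h' : ∀ a, P.Reach (P.sn a) (P.sn k) → c ∈ P.tpVars a → a ≠ k → P.Stable Δ a j) :
    P.Stable (P.step j Δ) k c := by
  intro t ht d hd a ha hca
  by_cases hak : a = k
  · subst hak
    exact ⟨t, ht, hd⟩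
  · obtain ⟨t', ht', hd'⟩ := h t ht.1 d hd a ha hca
    exact ⟨t', by rwa [(h' a ha hca hak).step_apply], hd'⟩

/-- The TP `k` contains `c` together with an ancestor of `c`; here `anc B` is the ancestor
relation in the tree of jvars of the block `B`. -/
def Hangs {β : Type*} (P : Pattern V C) (block : P.Occ → β) (anc : β → V → V → Prop) (k : P.Occ)
    (c : V) : Prop :=
  c ∈ P.tpVars k ∧ ∃ p ∈ P.tpVars k, anc (block k) p c

/-- The properties of the rooted trees of jvars on which `prune_triples` relies. The TPs are
partitioned into blocks (the TPs of the absolute masters, and those of each slave supernode); every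
block has a tree of jvars, with the ancestor relation `anc B`; the relation `below B B'` says that
the block `B` is treated before `B'`. -/
structure BlockForest {β : Type*} (P : Pattern V C) (block : P.Occ → β) (anc : β → V → V → Prop)
    (below : β → β → Prop) : Prop where
  block_eq : ∀ {k a c}, P.Hangs block anc k c → P.Reach (P.sn a) (P.sn k) → c ∈ P.tpVars a →
    block a = block k
  eq_of_hangs : ∀ {k a c}, P.Hangs block anc k c → P.Hangs block anc a c → block a = block k →
    a = k
  anc_or_anc : ∀ {a u v}, u ≠ v → P.IsJvar u → P.IsJvar v → u ∈ P.tpVars a → v ∈ P.tpVars a →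
    anc (block a) u v ∨ anc (block a) v u
  below_of_master : ∀ {a k}, P.Master (P.sn a) (P.sn k) → below (block a) (block k)

/-- The list `l` of (block, jvar) pairs contains, for every jvar of every TP, this jvar with the
block of the TP, and no entry comes before an entry by which, according to `prec`, it has to be
preceded. -/
structure Schedule {β : Type*} (P : Pattern V C) (block : P.Occ → β)
    (prec : β × V → β × V → Prop) (l : List (β × V)) : Prop where
  isJvar : ∀ x ∈ l, P.IsJvar x.2
  mem : ∀ k j, P.IsJvar j → j ∈ P.tpVars k → (block k, j) ∈ l
  pairwise : l.Pairwise fun x y => ¬ prec y x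

theorem mem_prefix_of_prec {α : Type*} {prec : α → α → Prop} {l₁ l₂ : List α}
    (h : (l₁ ++ l₂).Pairwise fun x y => ¬ prec y x) {x y : α} (hx : x ∈ l₁) (hy : y ∈ l₁ ++ l₂)
    (hxy : prec y x) : y ∈ l₁ :=
  (List.mem_append.1 hy).resolve_right fun hy' => (List.pairwise_append.1 h).2.2 x hx y hy' hxy

/-- The state after the steps on the jvars of `l`. -/
def run {β : Type*} (P : Pattern V C) (l : List (β × V)) (Δ : P.State) : P.State :=
  l.foldl (fun Δ x => P.step x.2 Δ) Δ

theorem run_le {β : Type*} (P : Pattern V C) (l : List (β × V)) (Δ : P.State) : P.run l Δ ≤ Δ :=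
  foldl_le (f := fun Δ (x : β × V) => P.step x.2 Δ) (fun Δ x => P.step_le x.2 Δ) l Δ

theorem run_concat {β : Type*} (P : Pattern V C) (l : List (β × V)) (x : β × V) (Δ : P.State) :
    P.run (l ++ [x]) Δ = P.step x.2 (P.run l Δ) := by
  simp [run]

variable {β : Type*} {P : Pattern V C} {block : P.Occ → β} {anc : β → V → V → Prop}
  {below : β → β → Prop}

/-- After the bottom-up pass, the value that a TP gives to the lower one of its two jvars is
supported: later steps do not change the TPs that hang below this jvar. -/
theorem BlockForest.stable_of_hangs_run (hF : P.BlockForest block anc below) {l : List (β × V)}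
    (hl : P.Schedule block (fun y x => y.1 = x.1 ∧ anc x.1 x.2 y.2) l) {Δ : P.State}
    (hΔ : P.Matched Δ) {k : P.Occ} {c : V} (hc : P.IsJvar c) (hk : P.Hangs block anc k c) :
    P.Stable (P.run l Δ) k c := by
  have key : ∀ l₁ l₂, l = l₁ ++ l₂ → ∀ k c, P.Hangs block anc k c → (block k, c) ∈ l₁ →
      P.Stable (P.run l₁ Δ) k c := by
    intro l₁
    induction l₁ using List.reverseRecOn with
    | nil => intro _ _ k c _ h; cases h
    | append_singleton l₁ x ih =>
      intro l₂ hl₂ k c hk hmem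
      rw [run_concat]
      have hmatch := hΔ.mono (P.run_le l₁ Δ)
      by_cases hxc : x.2 = c
      · rw [← hxc]
        exact stable_step_self hmatch k _
      have hmem : (block k, c) ∈ l₁ := (List.mem_append.1 hmem).resolve_right fun h => by
        rw [List.mem_singleton] at h
        exact hxc (by rw [← h])
      have hl₂' : l = l₁ ++ (x :: l₂) := by simp [hl₂]
      have hxl : x ∈ l := by simp [hl₂]
      have hcl : (block k, c) ∈ l := by rw [hl₂']; exact List.mem_append_left _ hmem
      refine (ih _ hl₂' k c hk hmem).step _ fun a ha hca hak => ?_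
      by_cases hxa : x.2 ∈ P.tpVars a
      · have hblock := hF.block_eq hk ha hca
        rcases hF.anc_or_anc hxc (hl.isJvar x hxl) (hl.isJvar _ hcl) hxa hca with h | h
        · exact (hak (hF.eq_of_hangs hk ⟨hca, _, hxa, h⟩ hblock)).elim
        · refine ih _ hl₂' a x.2 ⟨hxa, c, hca, h⟩ (mem_prefix_of_prec (hl₂' ▸ hl.pairwise) hmem
            (hl₂' ▸ hl.mem a _ (hl.isJvar x hxl) hxa) ⟨hblock, ?_⟩)
          rwa [← hblock]
      · exact stable_of_notMem _ hxa
  exact key l [] (by simp) k c hk (hl.mem k c hc hk.1)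

theorem BlockForest.stable_step_of_hangs (hF : P.BlockForest block anc below) {Δ : P.State}
    (hΔ : ∀ k c, P.IsJvar c → P.Hangs block anc k c → P.Stable Δ k c) {j : V} (hj : P.IsJvar j)
    (hmatch : P.Matched Δ) {k : P.Occ} {c : V} (hc : P.IsJvar c) (hk : P.Hangs block anc k c) :
    P.Stable (P.step j Δ) k c := by
  by_cases hjc : j = c
  · subst hjc
    exact stable_step_self hmatch k _
  refine (hΔ k c hc hk).step _ fun a ha hca hak => ?_
  by_cases hja : j ∈ P.tpVars a
  · rcases hF.anc_or_anc hjc hj hc hja hca with h | h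
    · exact (hak (hF.eq_of_hangs hk ⟨hca, _, hja, h⟩ (hF.block_eq hk ha hca))).elim
    · exact hΔ a j hj ⟨hja, c, hca, h⟩
  · exact stable_of_notMem _ hja

/-- If the lower jvars are already supported, then after the top-down pass everything is: a step
on `j` changes a TP only if `j` is its upper jvar, and then the lower one comes later. -/
theorem BlockForest.stable_run (hF : P.BlockForest block anc below) {l : List (β × V)}
    (hl : P.Schedule block (fun y x => (y.1 = x.1 ∧ anc x.1 y.2 x.2) ∨ below y.1 x.1) l)
    {Δ : P.State} (hmatch : P.Matched Δ)
    (hΔ : ∀ k c, P.IsJvar c → P.Hangs block anc k c → P.Stable Δ k c) (k : P.Occ) (c : V) :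
    P.Stable (P.run l Δ) k c := by
  have key : ∀ l₁ l₂, l = l₁ ++ l₂ →
      (∀ k c, P.IsJvar c → P.Hangs block anc k c → P.Stable (P.run l₁ Δ) k c) ∧
      ∀ k c, (block k, c) ∈ l₁ → P.Stable (P.run l₁ Δ) k c := by
    intro l₁
    induction l₁ using List.reverseRecOn with
    | nil => exact fun _ _ => ⟨hΔ, fun k c h => by cases h⟩
    | append_singleton l₁ x ih =>
      intro l₂ hl₂
      have hmatch' := hmatch.mono (P.run_le l₁ Δ)
      have hl₂' : l = l₁ ++ (x :: l₂) := by simp [hl₂]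
      have hx := hl.isJvar x (by simp [hl₂])
      obtain ⟨ih₁, ih₂⟩ := ih _ hl₂'
      rw [run_concat]
      refine ⟨fun k c hc hk => hF.stable_step_of_hangs ih₁ hx hmatch' hc hk, fun k c hmem => ?_⟩
      by_cases hxc : x.2 = c
      · rw [← hxc]
        exact stable_step_self hmatch' k _
      have hmem : (block k, c) ∈ l₁ := (List.mem_append.1 hmem).resolve_right fun h => by
        rw [List.mem_singleton] at h
        exact hxc (by rw [← h])
      by_cases hck : c ∈ P.tpVars k
      swap
      · exact stable_of_notMem _ hck
      have hc := hl.isJvar (block k, c) (by rw [hl₂']; exact List.mem_append_left _ hmem)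
      refine (ih₂ k c hmem).step _ fun a ha hca hak => ?_
      by_cases hxa : x.2 ∈ P.tpVars a
      · rcases hF.anc_or_anc hxc hx hc hxa hca with h | h
        · refine ih₂ a x.2 (mem_prefix_of_prec (hl₂' ▸ hl.pairwise) hmem
            (hl₂' ▸ hl.mem a _ hx hxa) ?_)
          by_cases hblock : block a = block k
          · exact Or.inl ⟨hblock, hblock ▸ h⟩
          · rcases reach_iff.1 ha with hs | hm
            · exact (hblock (hF.block_eq (k := a) ⟨hca, _, hxa, h⟩ hs.symm.reach hck).symm).elim
            · exact Or.inr (hF.below_of_master hm)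
        · exact ih₁ a _ hx ⟨hxa, c, hca, h⟩
      · exact stable_of_notMem _ hxa
  by_cases hc : P.IsJvar c
  · by_cases hck : c ∈ P.tpVars k
    · exact (key l [] (by simp)).2 k c (hl.mem k c hc hck)
    · exact stable_of_notMem _ hck
  · exact stable_of_not_isJvar _ hc

/-! ### The blocks of a query -/

open Classical in
/-- The block of a TP: `none` for the TPs of the absolute masters, and `some s` for those of a
slave supernode `s`. -/
noncomputable def blockOf (P : Pattern V C) (i : P.Occ) : Option P.SN :=
  if P.AbsoluteMaster (P.sn i) then none else some (P.sn i)

/-- The supernodes of a block. -/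
def blockSNs (P : Pattern V C) : Option P.SN → Set P.SN
  | none => {s | P.AbsoluteMaster s}
  | some s => {s}

/-- The possible roots of the tree of a block; `R` holds the root chosen in the absolute masters. -/
def blockRoots (P : Pattern V C) (R : Set V) : Option P.SN → Set V
  | none => R
  | some s => P.slaveRoots s

/-- The ancestor relation of the tree of a block. -/
def blockAnc (P : Pattern V C) (R : Set V) (B : Option P.SN) (p c : V) : Prop :=
  ∃ r ∈ P.blockRoots R B, ProperAncestor P.goj (P.jvarsOf (P.blockSNs B)) r p c

/-- The order in which the blocks are treated: the absolute masters first, and masters before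
their slaves. -/
def blockBelow (P : Pattern V C) : Option P.SN → Option P.SN → Prop
  | none, some _ => True
  | some s, some s' => P.Master s s'
  | _, none => False

/-- `R` holds the root of the tree on the jvars of the absolute masters, if there is one. -/
def IsMasterRoot (P : Pattern V C) (R : Set V) : Prop :=
  (P.masterJvars = ∅ ∧ R = ∅) ∨ ∃ root ∈ P.masterJvars, R = {root}

theorem sn_mem_blockSNs (P : Pattern V C) (i : P.Occ) : P.sn i ∈ P.blockSNs (P.blockOf i) := by
  unfold blockOf
  split
  · assumption
  · exact rfl

theorem blockOf_eq_some {P : Pattern V C} {i : P.Occ} {s : P.SN} (h : P.blockOf i = some s) :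
    P.sn i = s ∧ P.Slave s := by
  unfold blockOf at h
  split at h
  · cases h
  · rename_i h'
    cases h
    exact ⟨rfl, not_not.1 fun h => h' (not_slave_iff.1 h)⟩

theorem blockOf_of_slave {P : Pattern V C} {i : P.Occ} (h : P.Slave (P.sn i)) :
    P.blockOf i = some (P.sn i) := if_neg fun h' => not_slave_iff.2 h' h

theorem blockOf_of_absoluteMaster {P : Pattern V C} {i : P.Occ} (h : P.AbsoluteMaster (P.sn i)) :
    P.blockOf i = none := if_pos h

theorem setOf_absoluteMaster (P : Pattern V C) :
    {s | P.AbsoluteMaster s} = P.withPeers P.leftmost := by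
  ext s
  rw [mem_withPeers]
  exact absoluteMaster_iff_sameClass

theorem NoCartesianProducts.linked_blockSNs {P : Pattern V C} (hnc : P.NoCartesianProducts) :
    ∀ B, P.Linked (P.blockSNs B)
  | none => by
    rw [blockSNs, setOf_absoluteMaster]
    exact hnc.peers _
  | some s => hnc.bgps s

/-- A variable of a slave supernode that also occurs in one of its peers or masters is the root of
its tree. -/
theorem GojAcyclic.eq_slaveRoot {P : Pattern V C} (hac : P.GojAcyclic)
    (hnc : P.NoCartesianProducts) {s : P.SN} (hs : P.Slave s) {r : V} (hr : r ∈ P.slaveRoots s)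
    {v : V} {i k : P.Occ} (hi : P.sn i = s) (hvi : v ∈ P.tpVars i) (hk : P.Reach (P.sn k) s)
    (hks : P.sn k ≠ s) (hvk : v ∈ P.tpVars k) : v = r := by
  obtain ⟨⟨-, a, ha, hra⟩, -, b, hb, hrb⟩ := hr
  have hb' : P.Reach (P.sn b) s ∧ P.sn b ≠ s := ⟨Master.reach hb, fun h => by
    have := Master.depth_lt hb
    rw [h] at this
    omega⟩
  exact hac.eq_of_mem_of_disjoint (hnc.bgps s).tpLinked (hnc.tpLinked_reach_ne hs)
    (fun i hi hi' => hi'.2 hi) hi ha ⟨hk, hks⟩ hb' hvi hra hvk hrb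

theorem GojAcyclic.slaveRoots_subsingleton {P : Pattern V C} (hac : P.GojAcyclic)
    (hnc : P.NoCartesianProducts) {s : P.SN} (hs : P.Slave s) :
    (P.slaveRoots s).Subsingleton := by
  rintro v ⟨⟨-, a, ha, hva⟩, -, b, hb, hvb⟩ r hr
  refine hac.eq_slaveRoot hnc hs hr ha hva (Master.reach hb) (fun h => ?_) hvb
  have := Master.depth_lt hb
  rw [h] at this
  omega

theorem blockRoots_subset {P : Pattern V C} {R : Set V} (hR : P.IsMasterRoot R) :
    ∀ B, P.blockRoots R B ⊆ P.jvarsOf (P.blockSNs B)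
  | none => by
    rcases hR with ⟨-, rfl⟩ | ⟨root, hroot, rfl⟩
    · exact Set.empty_subset _
    · exact Set.singleton_subset_iff.2 hroot
  | some _ => Set.inter_subset_left

theorem blockRoots_subsingleton {P : Pattern V C} (hac : P.GojAcyclic)
    (hnc : P.NoCartesianProducts) {R : Set V} (hR : P.IsMasterRoot R) :
    ∀ B, (∀ s, B = some s → P.Slave s) → (P.blockRoots R B).Subsingleton
  | none, _ => by
    rcases hR with ⟨-, rfl⟩ | ⟨root, -, rfl⟩
    · exact Set.subsingleton_empty
    · exact Set.subsingleton_singleton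
  | some s, h => hac.slaveRoots_subsingleton hnc (h s rfl)

theorem blockRoots_nonempty {P : Pattern V C} (hnc : P.NoCartesianProducts) {R : Set V}
    (hR : P.IsMasterRoot R) : ∀ B, (∀ s, B = some s → P.Slave s) →
    (P.jvarsOf (P.blockSNs B)).Nonempty → (P.blockRoots R B).Nonempty
  | none, _, h => by
    rcases hR with ⟨hR, -⟩ | ⟨root, -, rfl⟩
    · exact (h.ne_empty hR).elim
    · exact ⟨root, rfl⟩
  | some s, h, _ => hnc.slaves s (h s rfl)

theorem blockForest {P : Pattern V C} (hac : P.GojAcyclic) (hnc : P.NoCartesianProducts)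
    {R : Set V} (hR : P.IsMasterRoot R) :
    P.BlockForest P.blockOf (P.blockAnc R) P.blockBelow where
  block_eq := by
    rintro k a c ⟨hck, p, -, r, hr, hp⟩ ha hca
    by_cases hk : P.Slave (P.sn k)
    · rw [blockOf_of_slave hk] at hr hp ⊢
      by_cases hak : P.sn a = P.sn k
      · rw [← hak, blockOf_of_slave (hak ▸ hk)]
      · exact (hp.ne_root (hac.eq_slaveRoot hnc hk hr rfl hck ha hak hca)).elim
    · rw [not_slave_iff] at hk
      rw [blockOf_of_absoluteMaster hk, blockOf_of_absoluteMaster fun x hx =>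
        hk x (hx.trans_reach ha)]
  eq_of_hangs := by
    rintro k a c ⟨hck, p, hpk, r, hr, hp⟩ ⟨hca, q, hqa, r', hr', hq⟩ hblock
    rw [hblock] at hr' hq
    obtain rfl := blockRoots_subsingleton hac hnc hR _ (fun s hs => (blockOf_eq_some hs).2) hr hr'
    have hpc : P.goj.Adj p c := ⟨hp.2.2.1, hp.2.1.1, hp.1.1, k, hpk, hck⟩
    have hqc : P.goj.Adj q c := ⟨hq.2.2.1, hq.2.1.1, hq.1.1, a, hqa, hca⟩
    obtain rfl := hp.eq_of_adj ((hnc.linked_blockSNs _).rootedIn (blockRoots_subset hR _ hr)) hq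
      hpc hqc
    by_contra hak
    exact hac.2 a k hak p c hpc.ne ⟨hqa, hca, hpk, hck⟩
  anc_or_anc := by
    intro a u v huv hu hv hua hva
    have hu' : u ∈ P.jvarsOf (P.blockSNs (P.blockOf a)) := ⟨hu, a, P.sn_mem_blockSNs a, hua⟩
    have hv' : v ∈ P.jvarsOf (P.blockSNs (P.blockOf a)) := ⟨hv, a, P.sn_mem_blockSNs a, hva⟩
    obtain ⟨r, hr⟩ := blockRoots_nonempty hnc hR _ (fun s hs => (blockOf_eq_some hs).2) ⟨u, hu'⟩
    exact (properAncestor_or_of_adj hac.1 ⟨huv, hu, hv, a, hua, hva⟩ hu' hv').imp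
      (fun h => ⟨r, hr, h⟩) (fun h => ⟨r, hr, h⟩)
  below_of_master := by
    intro a k h
    rw [blockOf_of_slave ⟨_, h⟩]
    unfold blockOf
    split
    · trivial
    · exact h

/-- A list of jvars, block by block. -/
def blockList (P : Pattern V C) (ss : List P.SN) (l : List V) (ls : P.SN → List V) :
    List (Option P.SN × V) :=
  l.map (Prod.mk none) ++ ss.flatMap fun s => (ls s).map (Prod.mk (some s))

theorem run_blockList (P : Pattern V C) (ss : List P.SN) (l : List V) (ls : P.SN → List V)
    (Δ : P.State) : P.run (P.blockList ss l ls) Δ =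
      (l ++ ss.flatMap ls).foldl (fun Δ j => P.step j Δ) Δ := by
  have h : l ++ ss.flatMap ls = (P.blockList ss l ls).map Prod.snd := by
    simp [blockList, List.map_flatMap, Function.comp_def]
  rw [h, List.foldl_map]
  rfl

/-- A list of jvars, block by block, is a schedule for the precedence `prec` if the slave
supernodes come in a permitted order and each block is listed according to `prec`. -/
theorem schedule_blockList {P : Pattern V C} {ssel : P.SN → ℕ} {ss : List P.SN}
    (hss : P.SlaveOrder ssel ss) {prec : Option P.SN × V → Option P.SN × V → Prop}
    (hprec : ∀ x y, prec y x → y.1 = x.1 ∨ P.blockBelow y.1 x.1)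
    {l : List V} {ls : P.SN → List V} (hl : ∀ v, v ∈ l ↔ v ∈ P.masterJvars)
    (hl' : l.Pairwise fun u w => ¬ prec (none, w) (none, u))
    (hls : ∀ s ∈ ss, ∀ v, v ∈ ls s ↔ v ∈ P.jvarsOf {s})
    (hls' : ∀ s ∈ ss, (ls s).Pairwise fun u w => ¬ prec (some s, w) (some s, u)) :
    P.Schedule P.blockOf prec (P.blockList ss l ls) where
  isJvar := by
    rintro ⟨B, v⟩ hx
    rcases List.mem_append.1 hx with hx | hx
    · obtain ⟨w, hw, h⟩ := List.mem_map.1 hx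
      cases h
      exact ((hl v).1 hw).1
    · obtain ⟨s, hs, hx⟩ := List.mem_flatMap.1 hx
      obtain ⟨w, hw, h⟩ := List.mem_map.1 hx
      cases h
      exact ((hls s hs v).1 hw).1
  mem := by
    intro k j hj hjk
    by_cases hk : P.Slave (P.sn k)
    · rw [blockOf_of_slave hk]
      refine List.mem_append_right _ (List.mem_flatMap.2 ⟨_, (hss.2.1 _).2 hk, ?_⟩)
      exact List.mem_map_of_mem ((hls _ ((hss.2.1 _).2 hk) j).2 ⟨hj, k, rfl, hjk⟩)
    · rw [not_slave_iff] at hk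
      rw [blockOf_of_absoluteMaster hk]
      exact List.mem_append_left _ (List.mem_map_of_mem ((hl j).2 ⟨hj, k, hk, hjk⟩))
  pairwise := by
    refine List.pairwise_append.2 ⟨List.pairwise_map.2 hl', ?_, ?_⟩
    · refine List.pairwise_flatMap.2 ⟨fun s hs => List.pairwise_map.2 (hls' s hs), ?_⟩
      refine (List.Pairwise.and hss.1 hss.2.2).imp ?_
      rintro s s' ⟨hne, hM, -⟩ x hx y hy hyx
      obtain ⟨u, -, rfl⟩ := List.mem_map.1 hx
      obtain ⟨w, -, rfl⟩ := List.mem_map.1 hy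
      rcases hprec _ _ hyx with h | h
      · exact hne (Option.some_injective _ h).symm
      · exact hM h
    · intro x hx y hy hyx
      obtain ⟨u, -, rfl⟩ := List.mem_map.1 hx
      obtain ⟨s, -, hy⟩ := List.mem_flatMap.1 hy
      obtain ⟨w, -, rfl⟩ := List.mem_map.1 hy
      rcases hprec _ _ hyx with h | h
      · cases h
      · exact h

theorem not_blockAnc {P : Pattern V C} {R : Set V} {B : Option P.SN} {root : V}
    (hB : (P.blockRoots R B).Subsingleton) (hroot : root ∈ P.blockRoots R B) {p c : V}
    (h : ¬ ProperAncestor P.goj (P.jvarsOf (P.blockSNs B)) root p c) : ¬ P.blockAnc R B p c := by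
  rintro ⟨r, hr, h'⟩
  rw [hB hr hroot] at h'
  exact h h'

/-- After the two passes, every remaining triple is supported, for every variable of its TP. -/
theorem stable_of_acyclicJvarOrder {P : Pattern V C} (hac : P.GojAcyclic)
    (hnc : P.NoCartesianProducts) {jsel : V → ℕ} {ssel : P.SN → ℕ} {ss : List P.SN}
    (hss : P.SlaveOrder ssel ss) {bu td : List V} (h : P.AcyclicJvarOrder jsel ss bu td)
    {Δ : P.State} (hΔ : P.Matched Δ) (k : P.Occ) (c : V) :
    P.Stable (td.foldl (fun Δ j => P.step j Δ) (bu.foldl (fun Δ j => P.step j Δ) Δ)) k c := by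
  obtain ⟨bum, tdm, bus, tds, hm, hbus, htds, rfl, rfl⟩ := h
  obtain ⟨R, hR, hbum, hbum', htdm, htdm'⟩ : ∃ R, P.IsMasterRoot R ∧
      (∀ v, v ∈ bum ↔ v ∈ P.masterJvars) ∧ bum.Pairwise (fun u w => ¬ P.blockAnc R none u w) ∧
      (∀ v, v ∈ tdm ↔ v ∈ P.masterJvars) ∧ tdm.Pairwise (fun u w => ¬ P.blockAnc R none w u) := by
    rcases hm with ⟨hm, rfl, rfl⟩ | ⟨root, hroot, -, hb, ht⟩
    · exact ⟨∅, Or.inl ⟨hm, rfl⟩, by simp [hm], .nil, by simp [hm], .nil⟩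
    · exact ⟨{root}, Or.inr ⟨root, hroot, rfl⟩, hb.2.1,
        hb.2.2.imp (not_blockAnc (B := none) Set.subsingleton_singleton rfl), ht.2.1,
        ht.2.2.imp (not_blockAnc (B := none) Set.subsingleton_singleton rfl)⟩
  have hsub : ∀ s ∈ ss, (P.blockRoots R (some s)).Subsingleton := fun s hs =>
    hac.slaveRoots_subsingleton hnc ((hss.2.1 s).1 hs)
  have hF := blockForest hac hnc hR
  have hbl := schedule_blockList hss (prec := fun y x => y.1 = x.1 ∧ P.blockAnc R x.1 x.2 y.2)
    (fun x y h => Or.inl h.1) hbum (hbum'.imp fun h h' => h h'.2)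
    (fun s hs => (hbus s hs).choose_spec.2.2.1) (fun s hs => by
      obtain ⟨root, hroot, h⟩ := hbus s hs
      refine h.2.2.imp ?_
      rintro u w h ⟨-, h'⟩
      exact not_blockAnc (hsub s hs) hroot h h')
  have htl := schedule_blockList hss
    (prec := fun y x => (y.1 = x.1 ∧ P.blockAnc R x.1 y.2 x.2) ∨ P.blockBelow y.1 x.1)
    (fun x y h => h.imp_left And.left) htdm (htdm'.imp fun h h' => h'.elim (fun h' => h h'.2) id)
    (fun s hs => (htds s hs).choose_spec.2.2.1) (fun s hs => by
      obtain ⟨root, hroot, h⟩ := htds s hs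
      refine h.2.2.imp fun h h' => h'.elim (fun h' => not_blockAnc (hsub s hs) hroot h h'.2) ?_
      intro (h' : P.Master s s)
      exact lt_irrefl _ h'.depth_lt)
  rw [← run_blockList, ← run_blockList]
  exact hF.stable_run htl (hΔ.mono (P.run_le _ _))
    (fun k c hc hk => hF.stable_of_hangs_run hbl hΔ hc hk) k c

/-! ### Supported triples contribute to final results -/

/-- If all triples are supported, then each triple of a TP `i` extends to a match of all TPs in the
supernode of `i`, its peers and its masters. The match is built TP by TP: from a TP to one that
supports it, and the acyclicity of the GoJ ensures that a new TP shares only one variable with the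
set of TPs matched before. -/
theorem exists_match {P : Pattern V C} (hwd : P.WellDesigned) (hnc : P.NoCartesianProducts)
    (hac : P.GojAcyclic) {Δ : P.State} (hΔ : P.Matched Δ) (hst : ∀ k c, P.Stable Δ k c)
    {i : P.Occ} {t : Triple C} (ht : t ∈ Δ i) :
    ∃ μ : V → C, (P.tp i).inst μ = t ∧
      ∀ k, P.Reach (P.sn k) (P.sn i) → (P.tp k).inst μ ∈ Δ k := by
  classical
  have := P.finite_occ
  let good : Set P.Occ → Prop := fun A => i ∈ A ∧ P.TpLinked A ∧
    ∃ μ : V → C, (P.tp i).inst μ = t ∧ ∀ k ∈ A, (P.tp k).inst μ ∈ Δ k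
  have hgood : good {i} := by
    obtain ⟨μ, hμ⟩ := hΔ i t ht
    refine ⟨rfl, P.tpLinked_singleton i, μ, hμ, ?_⟩
    rintro _ rfl
    rwa [hμ]
  obtain ⟨A, hA⟩ := (Set.toFinite {A | good A}).exists_maximal ⟨_, hgood⟩
  obtain ⟨hiA, hlA, μ, hμ, hμA⟩ := hA.prop
  -- By maximality, `A` contains all TPs that share a variable with, and support, a TP of `A`.
  have hclosed : ∀ a ∈ A, ∀ k, P.Reach (P.sn k) (P.sn a) →
      (P.tpVars a ∩ P.tpVars k).Nonempty → k ∈ A := by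
    rintro a ha k hka ⟨j, hja, hjk⟩
    by_contra hk
    obtain ⟨t', ht', hb⟩ := hst a j _ (hμA a ha) (μ j)
      (TriplePattern.binds_inst.2 ⟨hja, rfl⟩) k hka hjk
    obtain ⟨ν, rfl⟩ := hΔ k t' ht'
    have hνj : ν j = μ j := (TriplePattern.binds_inst.1 hb).2
    have hagree : ∀ b ∈ A, (P.tp b).inst (fun v => if v ∈ P.tpVars k then ν v else μ v) =
        (P.tp b).inst μ := by
      intro b hb
      refine TriplePattern.inst_congr fun v hv => ?_
      split
      · rename_i hvk
        have hvj : v = j := hac.eq_of_mem_of_disjoint hlA (P.tpLinked_singleton k)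
          (fun x hx hx' => hk (Set.mem_singleton_iff.1 hx' ▸ hx)) hb ha (Set.mem_singleton k)
          (Set.mem_singleton k) hv hja hvk hjk
        rw [hvj, hνj]
      · rfl
    have hk' : good (A ∪ {k}) := by
      refine ⟨Or.inl hiA, hlA.union (P.tpLinked_singleton k) ha (Set.mem_singleton k)
        ⟨j, hja, hjk⟩, _, (hagree i hiA).trans hμ, ?_⟩
      rintro b (hb | rfl)
      · rw [hagree b hb]
        exact hμA b hb
      · have hν : (P.tp b).inst (fun v => if v ∈ P.tpVars b then ν v else μ v) = (P.tp b).inst ν :=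
          TriplePattern.inst_congr fun v hv => if_pos hv
        rwa [hν]
    exact hk (hA.le_of_ge hk' Set.subset_union_left (Or.inr rfl))
  have hclass : ∀ a ∈ A, ∀ k, P.SameClass (P.sn a) (P.sn k) → k ∈ A := by
    intro a ha k hk
    induction (hnc.peers (P.sn a)) a k (mem_withPeers.2 .refl) (mem_withPeers.2 hk) with
    | refl => exact ha
    | @tail x y _ hxy ih =>
      have hx := mem_withPeers.1 hxy.1
      have hy := mem_withPeers.1 hxy.2.1
      exact hclosed x (ih hx) y (hy.symm.reach.trans hx.reach) hxy.2.2
  have hmain : ∀ x, P.Reach x (P.sn i) → ∀ k, P.SameClass x (P.sn k) → k ∈ A := by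
    intro x hx
    induction hx using Relation.ReflTransGen.head_induction_on with
    | refl => exact hclass i hiA
    | @head x y h hy ih =>
      rcases h with h | h
      · -- The variable that `y` shares with a master also occurs in the class of `x`.
        obtain ⟨v, ⟨-, b, hb, hvb⟩, -, m, hm, hvm⟩ := hnc.slaves y ⟨x, x, y, .refl, h, .refl⟩
        rw [Set.mem_singleton_iff] at hb
        obtain ⟨a, ha, hva⟩ := exists_sameClass_of_uni P hwd h v b (hb ▸ .refl) hvb
          (Or.inr ⟨m, fun hr => by
            have h₁ := hr.depth_le
            have h₂ := Master.depth_lt hm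
            omega, hvm⟩)
        have hbA : b ∈ A := ih b (hb ▸ .refl)
        have haA : a ∈ A := hclosed b hbA a
          (ha.symm.reach.trans (hb ▸ .single (Or.inl h))) ⟨v, hvb, hva⟩
        exact fun k hk => hclass a haA k (ha.symm.trans hk)
      · exact fun k hk => ih k (.head (bi_symm P h) hk)
  exact ⟨μ, hμ, fun k hk => hμA k (hmain _ hk k .refl)⟩

/-! ### The existence of an order -/

theorem exists_slaveOrder (P : Pattern V C) (ssel : P.SN → ℕ) : ∃ l, P.SlaveOrder ssel l := by
  classical
  have := P.finite_sn
  let key : P.SN → ℕ ×ₗ ℕ := fun s => toLex (P.depth s, ssel s)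
  refine ⟨(Set.toFinite {s | P.Slave s}).toFinset.toList.mergeSort
    (fun a b => decide (key a ≤ key b)), ?_, ?_, ?_⟩
  · exact (List.mergeSort_perm _ _).nodup_iff.2 (Finset.nodup_toList _)
  · intro s
    simp
  · refine (List.pairwise_mergeSort ?_ ?_ _).imp ?_
    · intro a b c
      simp only [decide_eq_true_eq]
      exact le_trans
    · intro a b
      simp only [Bool.or_eq_true, decide_eq_true_eq]
      exact le_total _ _
    · intro a b h
      simp only [decide_eq_true_eq, key, Prod.Lex.toLex_le_toLex] at h
      refine ⟨fun h' => ?_, fun h' => ?_⟩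
      · have := h'.depth_lt
        omega
      · have := SameClass.depth_eq h'.2
        omega

theorem exists_jvarOrder {P : Pattern V C} (hac : P.GojAcyclic) (hnc : P.NoCartesianProducts)
    (jsel : V → ℕ) (ssel : P.SN → ℕ) : ∃ bu td, P.JvarOrder jsel ssel bu td := by
  obtain ⟨ss, hss⟩ := P.exists_slaveOrder ssel
  have hs : ∀ s ∈ ss, ∃ l l', ∃ root ∈ P.slaveRoots s,
      BottomUp P.goj (P.jvarsOf {s}) root l ∧ TopDown P.goj (P.jvarsOf {s}) root l' := by
    intro s hs
    obtain ⟨root, hroot⟩ := hnc.slaves s ((hss.2.1 s).1 hs)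
    have hr := (hnc.bgps s).rootedIn hroot.1
    obtain ⟨l, hl⟩ := exists_bottomUp (P.finite_jvarsOf _) hr
    obtain ⟨l', hl'⟩ := exists_topDown (P.finite_jvarsOf _) hr
    exact ⟨l, l', root, hroot, hl, hl'⟩
  choose! bus tds hs using hs
  have hm : ∃ bum tdm, (P.masterJvars = ∅ ∧ bum = [] ∧ tdm = []) ∨
      ∃ root ∈ P.masterJvars, (∀ j ∈ P.masterJvars, jsel j ≤ jsel root) ∧
        BottomUp P.goj P.masterJvars root bum ∧ TopDown P.goj P.masterJvars root tdm := by
    rcases P.masterJvars.eq_empty_or_nonempty with h | h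
    · exact ⟨[], [], Or.inl ⟨h, rfl, rfl⟩⟩
    · have hfin : P.masterJvars.Finite := P.finite_jvarsOf _
      obtain ⟨root, hroot, hmax⟩ := Set.exists_max_image _ jsel hfin h
      have hr := (hnc.linked_blockSNs none).rootedIn hroot
      obtain ⟨l, hl⟩ := exists_bottomUp hfin hr
      obtain ⟨l', hl'⟩ := exists_topDown hfin hr
      exact ⟨l, l', Or.inr ⟨root, hroot, hmax, hl, hl'⟩⟩
  obtain ⟨bum, tdm, hm⟩ := hm
  refine ⟨_, _, Or.inr ⟨hac, ss, hss, bum, tdm, bus, tds, hm,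
    fun s h => ?_, fun s h => ?_, rfl, rfl⟩⟩
  · obtain ⟨root, hroot, hbu, -⟩ := hs s h
    exact ⟨root, hroot, hbu⟩
  · obtain ⟨root, hroot, -, htd⟩ := hs s h
    exact ⟨root, hroot, htd⟩

end Pattern
end LBR

/-! ### Correctness of `prune_triples` -/

theorem mainTheorem1 {V C : Type*} (Q : LBR.Pattern V C) (D : Set (LBR.Triple C))
    (_ : Q.Serialized) (hwd : Q.WellDesigned) (hnc : Q.NoCartesianProducts)
    (hac : Q.GojAcyclic)
    (jsel : V → ℕ) (ssel : Q.SN → ℕ)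
    (tps : List Q.Occ) (htps : ∀ i, i ∈ tps) (sns : List Q.SN) (hsns : ∀ s, s ∈ sns) :
    (∃ bu td, Q.JvarOrder jsel ssel bu td) ∧
      ∀ bu td, Q.JvarOrder jsel ssel bu td →
        ∀ i, Q.pruneTriples tps sns bu td (Q.matchingTriples D) i = Q.resultTriples D i := by
  refine ⟨LBR.Pattern.exists_jvarOrder hac hnc jsel ssel, fun bu td h i => ?_⟩
  obtain ⟨-, ss, hss, h⟩ := h.resolve_left fun h => h.1 hac
  have hΔ : Q.Matched (Q.matchingTriples D) := fun _ _ ht => ht.2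
  have hle : ∀ (l : List V) (Δ : Q.State), l.foldl (fun Δ j => Q.step j Δ) Δ ≤ Δ :=
    LBR.Pattern.foldl_le fun Δ j => Q.step_le j Δ
  have hres : ∀ (l : List V) (Δ : Q.State), Q.resultTriples D ≤ Δ →
      Q.resultTriples D ≤ l.foldl (fun Δ j => Q.step j Δ) Δ :=
    LBR.Pattern.foldl_induction fun Δ j h => LBR.Pattern.resultTriples_le_step h j
  have hst := LBR.Pattern.stable_of_acyclicJvarOrder hac hnc hss h hΔ
  have hbu := hle bu (Q.matchingTriples D)
  rw [LBR.Pattern.pruneTriples, LBR.Pattern.prunePass_eq htps hsns bu hΔ,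
    LBR.Pattern.prunePass_eq htps hsns td (hΔ.mono hbu)]
  have htd := (hle td (bu.foldl (fun Δ j => Q.step j Δ) (Q.matchingTriples D))).trans hbu
  refine Set.Subset.antisymm (fun t ht => ?_) (hres td _ (hres bu _ ?_) i)
  · obtain ⟨μ, rfl, hμ⟩ := LBR.Pattern.exists_match hwd hnc hac (hΔ.mono htd) hst ht
    obtain ⟨r, hr, hrμ⟩ := LBR.Pattern.exists_mem_eval μ Q hwd {x | Q.Reach x (Q.sn i)}
      (Q.leftmost_reach _) (fun a b hab hb => Relation.ReflTransGen.head hab hb)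
      (fun k hk => (htd k (hμ k hk)).1)
    exact ⟨r, hr, hrμ i .refl⟩
  · rintro k t ⟨r, hr, hk⟩
    exact LBR.Pattern.mem_matchingTriples_of_mem_eval Q hr hk
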